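/- Let $s$ be the Fréchet space of sequences $\xi=(\xi_j)_{j\ge1}\in\mathbb C^{\mathbb N}$ with $|\xi|_q:=(\sum_j|\xi_j|^2j^{2q})^{1/2}<\infty$ for all $q\in\mathbb N_0$, with the topology of the norms $|\cdot|_q$, and let $s'$ be the space of sequences with $|\xi|'_q:=(\sum_j|\xi_j|^2j^{-2q})^{1/2}<\infty$ for some $q\in\mathbb N_0$, with the locally convex inductive limit topology. Put $\langle\xi,\eta\rangle=\sum_j\xi_j\overline{\eta_j}$. Let $\mathcal L(s',s)$ be the algebra of continuous linear operators $s'\to s$ with the topology of uniform convergence on bounded subsets of $s'$, the multiplication $xy=x\circ j\circ y$, where $j\colon s\hookrightarrow s'$ is the inclusion, and the hermitian adjoint of operators on $\ell_2$ as involution. A closed commutative $*$-subalgebra of $\mathcal L(s',s)$ is *maximal commutative* if it is not properly contained in any other closed commutative $*$-subalgebra. The *canonical Schauder basis* of a closed commutative $*$-subalgebra $E$ consists of all nonzero minimal projections of $E$, each listed once. A sequence $(f_k)_{k\in\mathbb N}$ of elements of $s$ that is orthonormal in $\ell_2$ is *$s$-complete* if the only $\xi\in s$ with $\langle\xi,f_k\rangle=0$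 for all $k$ is $\xi=0$. For an orthonormal sequence $(f_k)$ in $s$, let $\lambda^\infty(|f_k|_q)$ be the Fréchet $*$-algebra of sequences $\xi$ with $\sup_k|\xi_k|\,|f_k|_q<\infty$ for all $q\in\mathbb N_0$, with the topology of these seminorms and pointwise multiplication and conjugation; let $e_k$ be its $k$-th unit vector. An isomorphism of Fréchet $*$-algebras is a $*$-isomorphism that is a homeomorphism. 1. Every closed maximal commutative $*$-subalgebra $E$ of $\mathcal L(s',s)$ is isomorphic as a Fréchet $*$-algebra to $\lambda^\infty(|f_k|_q)$ for some $s$-complete orthonormal sequence $(f_k)_{k\in\mathbb N}$, which can be chosen so that $(\langle\cdot,f_k\rangle f_k)_{k\in\mathbb N}$ is the canonical Schauder basis of $E$. 2. More precisely, if $E$ is a closed maximal commutative $*$-subalgebra of $\mathcal L(s',s)$ whose canonical Schauder basis is $(\langle\cdot,f_k\rangle f_k)_{k\in\mathbb N}$ for an orthonormal sequence $(f_k)_{k\in\mathbb N}$ in $s$, then $(f_k)$ is $s$-complete and there is exactly one isomorphism of Fréchet $*$-algebras $E\to\lambda^\infty(|f_k|_q)$ with $\langle\cdot,f_k\rangle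 f_k\mapsto e_k$ for all $k\in\mathbb N$. 3. Conversely, if $(f_k)_{k\in\mathbb N}$ is an $s$-complete orthonormal sequence, then $\lambda^\infty(|f_k|_q)$ is isomorphic as a Fréchet $*$-algebra to some closed maximal commutative $*$-subalgebra of $\mathcal L(s',s)$. -/

import Mathlib

open scoped ComplexConjugate

noncomputable section

namespace SmoothOp

/-! ### Weighted `ℓ₂`-norms of sequences

Sequences are indexed by `j = 0, 1, 2, …`, so that the weight of the `j`-th coordinate is a power
of `j + 1`. -/

/-- `∑ |ξ_j|² (j+1)^{2q} < ∞`. -/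
def WSummable (q : ℤ) (ξ : ℕ → ℂ) : Prop :=
  Summable fun j : ℕ => ‖ξ j‖ ^ 2 * ((j : ℝ) + 1) ^ (2 * q)

/-- `(∑ |ξ_j|² (j+1)^{2q})^{1/2}`. For `q ≥ 0` this is `|ξ|_q`; with `-q` in place of `q` it is
the dual norm `|ξ|'_q`. -/
def wnorm (q : ℤ) (ξ : ℕ → ℂ) : ℝ :=
  Real.sqrt (∑' j : ℕ, ‖ξ j‖ ^ 2 * ((j : ℝ) + 1) ^ (2 * q))

theorem wnorm_nonneg (q : ℤ) (ξ : ℕ → ℂ) : 0 ≤ wnorm q ξ := Real.sqrt_nonneg _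

theorem norm_weight (q : ℤ) (ξ : ℕ → ℂ) (j : ℕ) :
    ‖(((((j : ℝ) + 1) ^ q : ℝ)) : ℂ) * ξ j‖ ^ (2 : ENNReal).toReal
      = ‖ξ j‖ ^ 2 * ((j : ℝ) + 1) ^ (2 * q) := by
  have h : (0 : ℝ) < (j : ℝ) + 1 := by positivity
  have h2 : (0 : ℝ) < ((j : ℝ) + 1) ^ q := zpow_pos h q
  rw [norm_mul, Complex.norm_real, Real.norm_of_nonneg h2.le]
  have : (2 : ENNReal).toReal = ((2 : ℕ) : ℝ) := by simp
  rw [this, Real.rpow_natCast, mul_pow, mul_comm, mul_comm (2 : ℤ) q, zpow_mul]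
  norm_cast

/-- The weighted sequence `((j+1)^q ξ_j)` as an element of `ℓ₂`. -/
def toL2 (q : ℤ) (ξ : ℕ → ℂ) (h : WSummable q ξ) : lp (fun _ : ℕ => ℂ) 2 :=
  ⟨fun j => (((((j : ℝ) + 1) ^ q : ℝ)) : ℂ) * ξ j,
    memℓp_gen (by simp only [norm_weight]; exact h)⟩

theorem norm_toL2 (q : ℤ) (ξ : ℕ → ℂ) (h : WSummable q ξ) : ‖toL2 q ξ h‖ = wnorm q ξ := by
  rw [lp.norm_eq_tsum_rpow (by simp)]
  simp only [toL2, norm_weight]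
  rw [wnorm, Real.sqrt_eq_rpow]
  simp

theorem wsummable_of_memℓp {q : ℤ} {ξ : ℕ → ℂ}
    (h : Memℓp (fun j : ℕ => (((((j : ℝ) + 1) ^ q : ℝ)) : ℂ) * ξ j) 2) : WSummable q ξ := by
  have := (memℓp_gen_iff (by simp)).1 h
  simp only [norm_weight] at this
  exact this

theorem WSummable.add {q : ℤ} {ξ η : ℕ → ℂ} (hξ : WSummable q ξ) (hη : WSummable q η) :
    WSummable q (ξ + η) := by
  apply wsummable_of_memℓp
  have h : (fun j : ℕ => (((((j : ℝ) + 1) ^ q : ℝ)) : ℂ) * (ξ + η) j)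
      = (toL2 q ξ hξ + toL2 q η hη : lp (fun _ : ℕ => ℂ) 2) :=
    funext fun j => mul_add _ (ξ j) (η j)
  rw [h]
  exact (toL2 q ξ hξ + toL2 q η hη).2

theorem WSummable.smul {q : ℤ} {ξ : ℕ → ℂ} (c : ℂ) (hξ : WSummable q ξ) :
    WSummable q (c • ξ) := by
  refine (Summable.mul_left (‖c‖ ^ 2) hξ).congr fun j => ?_
  simp [mul_pow, mul_assoc]

theorem wsummable_zero (q : ℤ) : WSummable q 0 := by simp [WSummable, summable_zero]

theorem WSummable.mono {q r : ℤ} (hqr : q ≤ r) {ξ : ℕ → ℂ} (h : WSummable r ξ) :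
    WSummable q ξ := by
  refine Summable.of_nonneg_of_le (fun j => by positivity) (fun j => ?_) h
  have : (1 : ℝ) ≤ (j : ℝ) + 1 := by simp
  gcongr

theorem wnorm_add_le {q : ℤ} {ξ η : ℕ → ℂ} (hξ : WSummable q ξ) (hη : WSummable q η) :
    wnorm q (ξ + η) ≤ wnorm q ξ + wnorm q η := by
  rw [← norm_toL2 q ξ hξ, ← norm_toL2 q η hη, ← norm_toL2 q _ (hξ.add hη)]
  have : toL2 q _ (hξ.add hη) = toL2 q ξ hξ + toL2 q η hη := by
    ext j
    exact mul_add _ (ξ j) (η j)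
  rw [this]
  exact norm_add_le _ _

theorem wnorm_smul (q : ℤ) (c : ℂ) (ξ : ℕ → ℂ) : wnorm q (c • ξ) = ‖c‖ * wnorm q ξ := by
  have : (fun j : ℕ => ‖(c • ξ) j‖ ^ 2 * ((j : ℝ) + 1) ^ (2 * q))
      = fun j : ℕ => ‖c‖ ^ 2 * (‖ξ j‖ ^ 2 * ((j : ℝ) + 1) ^ (2 * q)) := by
    funext j
    simp [mul_pow, mul_assoc]
  rw [wnorm, wnorm, this, tsum_mul_left, Real.sqrt_mul (by positivity),
    Real.sqrt_sq (norm_nonneg c)]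

theorem wnorm_mono {q r : ℤ} (hqr : q ≤ r) {ξ : ℕ → ℂ} (h : WSummable r ξ) :
    wnorm q ξ ≤ wnorm r ξ := by
  refine Real.sqrt_le_sqrt ((h.mono hqr).tsum_le_tsum (fun j => ?_) h)
  have : (1 : ℝ) ≤ (j : ℝ) + 1 := by simp
  gcongr

theorem inner_weight (q : ℤ) (ξ η : ℕ → ℂ) (j : ℕ) :
    inner ℂ ((((((j : ℝ) + 1) ^ q : ℝ)) : ℂ) * η j) ((((((j : ℝ) + 1) ^ (-q) : ℝ)) : ℂ) * ξ j)
      = ξ j * conj (η j) := by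
  have h : ((j : ℝ) + 1) ≠ 0 := by positivity
  have h2 : ((j : ℝ) + 1) ^ (-q) * ((j : ℝ) + 1) ^ q = 1 := by
    rw [← zpow_add₀ h]; simp
  have h3 : ((((((j : ℝ) + 1) ^ (-q) : ℝ)) : ℂ)) * (((((j : ℝ) + 1) ^ q : ℝ)) : ℂ) = 1 := by
    exact_mod_cast h2
  rw [RCLike.inner_apply, map_mul, Complex.conj_ofReal]
  linear_combination (ξ j * conj (η j)) * h3

theorem summable_pairing {q : ℤ} {ξ η : ℕ → ℂ} (hξ : WSummable (-q) ξ) (hη : WSummable q η) :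
    Summable fun j => ξ j * conj (η j) := by
  have := lp.summable_inner (𝕜 := ℂ) (toL2 q η hη) (toL2 (-q) ξ hξ)
  simpa only [toL2, inner_weight] using this

theorem norm_pairing_le {q : ℤ} {ξ η : ℕ → ℂ} (hξ : WSummable (-q) ξ) (hη : WSummable q η) :
    ‖∑' j, ξ j * conj (η j)‖ ≤ wnorm (-q) ξ * wnorm q η := by
  have h := lp.inner_eq_tsum (𝕜 := ℂ) (toL2 q η hη) (toL2 (-q) ξ hξ)
  simp only [toL2, inner_weight] at h
  rw [← h, ← norm_toL2 q η hη, ← norm_toL2 (-q) ξ hξ, mul_comm]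
  exact norm_inner_le_norm _ _

/-! ### The space `s` of rapidly decreasing sequences -/

/-- The vector space underlying `s`. -/
def sSubmodule : Submodule ℂ (ℕ → ℂ) where
  carrier := {ξ | ∀ q : ℕ, WSummable q ξ}
  add_mem' h h' q := (h q).add (h' q)
  zero_mem' q := wsummable_zero q
  smul_mem' c _ h q := (h q).smul c

/-- The space `s` of rapidly decreasing sequences. -/
def S : Type := sSubmodule

instance : AddCommGroup S := inferInstanceAs (AddCommGroup sSubmodule)
instance : Module ℂ S := inferInstanceAs (Module ℂ sSubmodule)
instance : CoeFun S (fun _ => ℕ → ℂ) := ⟨fun ξ => Subtype.val ξ⟩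

/-- The norm `|·|_q` on `s`. -/
def S.norm (q : ℕ) : Seminorm ℂ S :=
  Seminorm.of (fun ξ : S => wnorm q ξ)
    (fun ξ η => wnorm_add_le (ξ.2 q) (η.2 q)) (fun c ξ => wnorm_smul q c ξ)

/-- The system `(|·|_q)_q` of norms of `s`. -/
def S.norms : SeminormFamily ℂ S ℕ := S.norm

/-- The topology of `s` is given by the norms `|·|_q`. -/
instance : TopologicalSpace S := S.norms.moduleFilterBasis.topology

theorem S.withSeminorms : WithSeminorms S.norms := ⟨rfl⟩

instance : IsTopologicalAddGroup S := S.withSeminorms.topologicalAddGroup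
instance : ContinuousSMul ℂ S := S.withSeminorms.continuousSMul

/-! ### The space `s'` of slowly increasing sequences -/

/-- The vector space underlying `s'`. -/
def sDualSubmodule : Submodule ℂ (ℕ → ℂ) where
  carrier := {ξ | ∃ q : ℕ, WSummable (-(q : ℤ)) ξ}
  add_mem' := by
    rintro ξ η ⟨q, hq⟩ ⟨r, hr⟩
    exact ⟨max q r, (hq.mono (by simp)).add (hr.mono (by simp))⟩
  zero_mem' := ⟨0, wsummable_zero _⟩
  smul_mem' c _ h := ⟨h.choose, h.choose_spec.smul c⟩

/-- The space `s'` of slowly increasing sequences. -/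
def SDual : Type := sDualSubmodule

instance : AddCommGroup SDual := inferInstanceAs (AddCommGroup sDualSubmodule)
instance : Module ℂ SDual := inferInstanceAs (Module ℂ sDualSubmodule)
instance : CoeFun SDual (fun _ => ℕ → ℂ) := ⟨fun ξ => Subtype.val ξ⟩

/-- A seminorm on `s'` whose restriction to each step `{ξ : |ξ|'_q < ∞}` is continuous for the
norm `|·|'_q`. -/
def SDual.Admissible (p : Seminorm ℂ SDual) : Prop :=
  ∀ q : ℕ, ∃ C : ℝ, ∀ ξ : SDual, WSummable (-(q : ℤ)) ξ → p ξ ≤ C * wnorm (-(q : ℤ)) ξ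

/-- The family of all admissible seminorms on `s'`. -/
def SDual.seminorms : SeminormFamily ℂ SDual {p : Seminorm ℂ SDual // SDual.Admissible p} :=
  fun p => p.1

instance : Nonempty {p : Seminorm ℂ SDual // SDual.Admissible p} :=
  ⟨⟨0, fun _ => ⟨0, fun ξ _ => by simp⟩⟩⟩

/-- The (locally convex) inductive limit topology of `s'`: the finest locally convex topology for
which the inclusions of all the steps `({ξ : |ξ|'_q < ∞}, |·|'_q)` are continuous, that is, the
one given by all seminorms that are continuous on every step. -/
instance : TopologicalSpace SDual := SDual.seminorms.moduleFilterBasis.topology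

theorem SDual.withSeminorms : WithSeminorms SDual.seminorms := ⟨rfl⟩

instance : IsTopologicalAddGroup SDual := SDual.withSeminorms.topologicalAddGroup
instance : ContinuousSMul ℂ SDual := SDual.withSeminorms.continuousSMul

theorem SDual.continuous_of_admissible {p : Seminorm ℂ SDual} (hp : SDual.Admissible p) :
    Continuous p :=
  SDual.withSeminorms.continuous_seminorm ⟨p, hp⟩

theorem SDual.admissible_of_continuous {p : Seminorm ℂ SDual} (hp : Continuous p) :
    SDual.Admissible p := by
  obtain ⟨t, C, -, hC⟩ := Seminorm.bound_of_continuous SDual.withSeminorms p hp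
  intro q
  have key : ∃ D : ℝ, ∀ ξ : SDual, WSummable (-(q : ℤ)) ξ →
      (t.sup SDual.seminorms) ξ ≤ D * wnorm (-(q : ℤ)) ξ := by
    clear hC
    classical
    induction t using Finset.induction_on with
    | empty => exact ⟨0, fun ξ _ => by simp⟩
    | insert a t _ ih =>
      obtain ⟨D, hD⟩ := ih
      obtain ⟨D', hD'⟩ := a.2 q
      refine ⟨max D' D, fun ξ hξ => ?_⟩
      rw [Finset.sup_insert, Seminorm.sup_apply]
      exact max_le
        ((hD' ξ hξ).trans (mul_le_mul_of_nonneg_right (le_max_left _ _) (wnorm_nonneg _ _)))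
        ((hD ξ hξ).trans (mul_le_mul_of_nonneg_right (le_max_right _ _) (wnorm_nonneg _ _)))
  obtain ⟨D, hD⟩ := key
  refine ⟨C * D, fun ξ hξ => (hC ξ).trans ?_⟩
  rw [smul_apply, NNReal.smul_def, smul_eq_mul, mul_assoc]
  exact mul_le_mul_of_nonneg_left (hD ξ hξ) C.2

/-- A linear map `s' → s` that is bounded from every step to every normed level is continuous. -/
def SDual.mkCLM (T : SDual →ₗ[ℂ] S)
    (hT : ∀ q r : ℕ, ∃ C : ℝ, ∀ ξ : SDual, WSummable (-(r : ℤ)) ξ →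
      wnorm q (T ξ) ≤ C * wnorm (-(r : ℤ)) ξ) : SDual →L[ℂ] S :=
  ⟨T, WithSeminorms.continuous_of_continuous_comp S.withSeminorms T fun q =>
    SDual.continuous_of_admissible (hT q)⟩

theorem SDual.exists_bound (x : SDual →L[ℂ] S) (q r : ℕ) :
    ∃ C : ℝ, ∀ ξ : SDual, WSummable (-(r : ℤ)) ξ → wnorm q (x ξ) ≤ C * wnorm (-(r : ℤ)) ξ :=
  SDual.admissible_of_continuous (p := (S.norm q).comp x.toLinearMap)
    ((S.withSeminorms.continuous_seminorm q).comp x.continuous) r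

/-- The embedding `j : s ↪ s'`. -/
def incl : S →L[ℂ] SDual where
  toFun ξ := ⟨ξ.1, 0, by simpa using ξ.2 0⟩
  map_add' _ _ := rfl
  map_smul' _ _ := rfl
  cont := by
    let T : S →ₗ[ℂ] SDual :=
      { toFun := fun ξ => ⟨ξ.1, 0, by simpa using ξ.2 0⟩
        map_add' := fun _ _ => rfl
        map_smul' := fun _ _ => rfl }
    refine WithSeminorms.continuous_of_continuous_comp SDual.withSeminorms T fun p => ?_
    obtain ⟨C, hC⟩ := p.2 0
    have hle : (SDual.seminorms p).comp T ≤ (‖C‖₊ : NNReal) • S.norm 0 := fun ξ => by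
      refine (hC (T ξ) (ξ.2 0)).trans ?_
      rw [smul_apply, NNReal.smul_def, smul_eq_mul]
      exact mul_le_mul_of_nonneg_right (Real.le_norm_self C) (wnorm_nonneg _ _)
    exact Seminorm.continuous_of_le
      ((S.withSeminorms.continuous_seminorm 0).const_smul (‖C‖₊ : NNReal)) hle

/-- The pairing `⟨η, ξ⟩ = ∑ η_j conj(ξ_j)` of `η ∈ s'` and `ξ ∈ s`. -/
def pair (η : SDual) (ξ : S) : ℂ := ∑' j, η j * conj (ξ j)

theorem summable_pair (η : SDual) (ξ : S) : Summable fun j => η j * conj (ξ j) := by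
  obtain ⟨q, hq⟩ := η.2
  exact summable_pairing hq (ξ.2 q)

theorem norm_pair_le {q : ℕ} {η : SDual} (hη : WSummable (-(q : ℤ)) η) (ξ : S) :
    ‖pair η ξ‖ ≤ wnorm (-(q : ℤ)) η * wnorm q ξ :=
  norm_pairing_le hη (ξ.2 q)

theorem pair_add (η η' : SDual) (ξ : S) : pair (η + η') ξ = pair η ξ + pair η' ξ := by
  unfold pair
  rw [← (summable_pair η ξ).tsum_add (summable_pair η' ξ)]
  exact tsum_congr fun j => add_mul (η j) (η' j) _

theorem pair_smul (c : ℂ) (η : SDual) (ξ : S) : pair (c • η) ξ = c * pair η ξ := by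
  unfold pair
  rw [← tsum_mul_left]
  exact tsum_congr fun j => mul_assoc c (η j) _

/-! ### The algebra `𝓛(s', s)` -/

/-- The space `𝓛(s', s)` of continuous linear operators from `s'` to `s`, with the topology of
uniform convergence on bounded subsets of `s'`. -/
def LSS : Type := SDual →L[ℂ] S

instance : AddCommGroup LSS := inferInstanceAs (AddCommGroup (SDual →L[ℂ] S))
instance : Module ℂ LSS := inferInstanceAs (Module ℂ (SDual →L[ℂ] S))
instance : TopologicalSpace LSS := inferInstanceAs (TopologicalSpace (SDual →L[ℂ] S))
instance : FunLike LSS SDual S := inferInstanceAs (FunLike (SDual →L[ℂ] S) SDual S)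

/-- The multiplication `x y = x ∘ j ∘ y`. -/
instance : Mul LSS := ⟨fun x y =>
  (ContinuousLinearMap.comp (show SDual →L[ℂ] S from x)
    (incl.comp (show SDual →L[ℂ] S from y)) : SDual →L[ℂ] S)⟩

theorem LSS.mul_apply (x y : LSS) (ξ : SDual) : (x * y) ξ = x (incl (y ξ)) := rfl

theorem LSS.ext {x y : LSS} (h : ∀ ξ, x ξ = y ξ) : x = y := DFunLike.ext _ _ h

theorem LSS.map_add (x : LSS) (ξ η : SDual) : x (ξ + η) = x ξ + x η :=
  ContinuousLinearMap.map_add (show SDual →L[ℂ] S from x) ξ η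

theorem LSS.map_zero (x : LSS) : x 0 = 0 :=
  ContinuousLinearMap.map_zero (show SDual →L[ℂ] S from x)

theorem LSS.map_smul (x : LSS) (c : ℂ) (ξ : SDual) : x (c • ξ) = c • x ξ :=
  ContinuousLinearMap.map_smul (show SDual →L[ℂ] S from x) c ξ

instance : NonUnitalRing LSS :=
  { (inferInstance : AddCommGroup LSS), (inferInstance : Mul LSS) with
    left_distrib := fun x y z => LSS.ext fun ξ => by
      change x (incl (y ξ + z ξ)) = x (incl (y ξ)) + x (incl (z ξ))
      rw [_root_.map_add, LSS.map_add]
    right_distrib := fun _ _ _ => rfl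
    zero_mul := fun _ => rfl
    mul_zero := fun x => LSS.ext fun ξ => by
      change x (incl 0) = 0
      rw [_root_.map_zero, LSS.map_zero]
    mul_assoc := fun _ _ _ => rfl }

/-- The unit vector `e_i` as an element of `s'`. -/
def unitVec (i : ℕ) : SDual :=
  ⟨Pi.single i 1, 0, summable_of_ne_finset_zero (s := {i}) fun j hj => by
    have : j ≠ i := by simpa using hj
    simp [this]⟩

theorem unitVec_wsummable (q : ℤ) (i : ℕ) : WSummable q (unitVec i) :=
  summable_of_ne_finset_zero (s := {i}) fun j hj => by
    have : j ≠ i := by simpa using hj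
    simp [unitVec, this]

theorem wnorm_unitVec (q : ℤ) (i : ℕ) : wnorm q (unitVec i) = ((i : ℝ) + 1) ^ q := by
  rw [wnorm, tsum_eq_single i (fun j hj => by simp [unitVec, hj])]
  have h : (0 : ℝ) < (i : ℝ) + 1 := by positivity
  simp only [unitVec, Pi.single_eq_same, norm_one, one_pow, one_mul]
  rw [mul_comm, zpow_mul, zpow_ofNat, Real.sqrt_sq (zpow_pos h q).le]

theorem summable_inv_sq : Summable fun j : ℕ => ((j : ℝ) + 1) ^ (-2 : ℤ) := by
  have h := (summable_nat_add_iff 1).2 (Real.summable_nat_pow_inv.2 (one_lt_two))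
  refine h.congr fun j => ?_
  rw [zpow_neg]
  norm_cast

/-- A sequence bounded by `D (j+1)^{-(q+1)}` has finite norm `|·|_q`, controlled by `D`. -/
theorem wsummable_of_bound {q : ℕ} {D : ℝ} {ζ : ℕ → ℂ}
    (h : ∀ j : ℕ, ‖ζ j‖ ≤ D * ((j : ℝ) + 1) ^ (-((q : ℤ) + 1))) :
    WSummable q ζ ∧ wnorm q ζ ≤ D * Real.sqrt (∑' j : ℕ, ((j : ℝ) + 1) ^ (-2 : ℤ)) := by
  have hD : 0 ≤ D := by simpa using (norm_nonneg _).trans (h 0)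
  have hle : ∀ j : ℕ, ‖ζ j‖ ^ 2 * ((j : ℝ) + 1) ^ (2 * (q : ℤ))
      ≤ D ^ 2 * ((j : ℝ) + 1) ^ (-2 : ℤ) := by
    intro j
    have hj : ((j : ℝ) + 1) ≠ 0 := by positivity
    calc ‖ζ j‖ ^ 2 * ((j : ℝ) + 1) ^ (2 * (q : ℤ))
        ≤ (D * ((j : ℝ) + 1) ^ (-((q : ℤ) + 1))) ^ 2 * ((j : ℝ) + 1) ^ (2 * (q : ℤ)) := by
          gcongr
          exact h j
      _ = D ^ 2 * ((j : ℝ) + 1) ^ (-2 : ℤ) := by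
          rw [mul_pow, mul_assoc, ← zpow_natCast (((j : ℝ) + 1) ^ (-((q : ℤ) + 1))) 2,
            ← zpow_mul, ← zpow_add₀ hj]
          congr 2
          push_cast
          ring
  have hs := summable_inv_sq.mul_left (D ^ 2)
  have hw : WSummable q ζ := Summable.of_nonneg_of_le (fun j => by positivity) hle hs
  refine ⟨hw, ?_⟩
  have h2 := Real.sqrt_le_sqrt (hw.tsum_le_tsum hle hs)
  rwa [tsum_mul_left, Real.sqrt_mul (by positivity), Real.sqrt_sq hD] at h2

theorem LSS.adjoint_bound (x : LSS) (q r : ℕ) :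
    ∃ C : ℝ, ∀ ξ : SDual, WSummable (-(r : ℤ)) ξ → ∀ i : ℕ,
      ‖pair ξ (x (unitVec i))‖ ≤ C * wnorm (-(r : ℤ)) ξ * ((i : ℝ) + 1) ^ (-((q : ℤ) + 1)) := by
  obtain ⟨C, hC⟩ := SDual.exists_bound x r (q + 1)
  refine ⟨C, fun ξ hξ i => (norm_pair_le hξ _).trans ?_⟩
  have h := hC (unitVec i) (unitVec_wsummable _ i)
  rw [wnorm_unitVec] at h
  push_cast at h
  calc _ ≤ wnorm (-(r : ℤ)) ξ * (C * ((i : ℝ) + 1) ^ (-((q : ℤ) + 1))) :=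
        mul_le_mul_of_nonneg_left h (wnorm_nonneg _ _)
    _ = _ := by ring

/-- The hermitian adjoint of `x`: its `i`-th coordinate is `⟨x* ξ, e_i⟩ = ⟨ξ, x e_i⟩`. -/
def LSS.adjoint (x : LSS) : LSS :=
  SDual.mkCLM
    { toFun := fun ξ => ⟨fun i => pair ξ (x (unitVec i)), fun q => by
        obtain ⟨r, hr⟩ := ξ.2
        obtain ⟨C, hC⟩ := x.adjoint_bound q r
        exact (wsummable_of_bound (hC ξ hr)).1⟩
      map_add' := fun ξ η => Subtype.ext (funext fun i => pair_add ξ η _)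
      map_smul' := fun c ξ => Subtype.ext (funext fun i => pair_smul c ξ _) }
    (fun q r => by
      obtain ⟨C, hC⟩ := x.adjoint_bound q r
      refine ⟨C * Real.sqrt (∑' j : ℕ, ((j : ℝ) + 1) ^ (-2 : ℤ)), fun ξ hξ => ?_⟩
      refine (wsummable_of_bound (hC ξ hξ)).2.trans (le_of_eq ?_)
      ring)

/-- The involution of `𝓛(s', s)` is the hermitian adjoint. -/
instance : Star LSS := ⟨LSS.adjoint⟩

/-- The one-dimensional operator `⟨·, f⟩ f` for `f ∈ s`. -/
def rankOne (f : S) : LSS :=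
  SDual.mkCLM
    { toFun := fun ξ => pair ξ f • f
      map_add' := fun ξ η => by rw [pair_add, add_smul]
      map_smul' := fun c ξ => by rw [pair_smul, mul_smul]; rfl }
    (fun q r => ⟨wnorm r f * wnorm q f, fun ξ hξ => by
      refine (wnorm_smul q (pair ξ f) f).trans_le ?_
      calc _ ≤ (wnorm (-(r : ℤ)) ξ * wnorm r f) * wnorm q f :=
            mul_le_mul_of_nonneg_right (norm_pair_le hξ f) (wnorm_nonneg _ _)
        _ = _ := by ring⟩)

/-! ### Closed maximal commutative `*`-subalgebras and their canonical bases -/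

/-- `E` is a closed commutative `*`-subalgebra of `𝓛(s', s)`. -/
def IsClosedCommutative (E : NonUnitalStarSubalgebra ℂ LSS) : Prop :=
  IsClosed (E : Set LSS) ∧ ∀ x ∈ E, ∀ y ∈ E, x * y = y * x

/-- `E` is a closed maximal commutative `*`-subalgebra: closed, commutative, and not properly
contained in any other closed commutative `*`-subalgebra. -/
def IsClosedMaximalCommutative (E : NonUnitalStarSubalgebra ℂ LSS) : Prop :=
  IsClosedCommutative E ∧
    ∀ F : NonUnitalStarSubalgebra ℂ LSS, IsClosedCommutative F → E ≤ F → F = E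

/-- `P` is a minimal element among the nonzero projections of `E`, where `Q ≤ P` means
`Q P = Q`. -/
structure IsMinimalProjection (E : NonUnitalStarSubalgebra ℂ LSS) (P : LSS) : Prop where
  mem : P ∈ E
  isStarProjection : IsStarProjection P
  ne_zero : P ≠ 0
  minimal : ∀ Q ∈ E, IsStarProjection Q → Q ≠ 0 → Q * P = Q → Q = P

/-- `(P_k)` is the canonical Schauder basis of `E`: it consists of all the nonzero minimal
projections of `E`, each listed once. (That these form a Schauder basis is a consequence.) -/
structure IsCanonicalBasis (E : NonUnitalStarSubalgebra ℂ LSS) (P : ℕ → LSS) : Prop where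
  injective : Function.Injective P
  isMinimalProjection : ∀ k, IsMinimalProjection E (P k)
  exhaustive : ∀ Q, IsMinimalProjection E Q → ∃ k, P k = Q

/-! ### Orthonormal sequences in `s` -/

/-- A sequence of elements of `s` that is orthonormal in `ℓ₂`. -/
structure OrthonormalSeq where
  toFun : ℕ → S
  orthonormal : ∀ k l, pair (incl (toFun k)) (toFun l) = if k = l then 1 else 0

instance : CoeFun OrthonormalSeq (fun _ => ℕ → S) := ⟨OrthonormalSeq.toFun⟩

/-- `(f_k)` is `s`-complete: no nonzero element of `s` is orthogonal to all `f_k`. -/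
def OrthonormalSeq.IsSComplete (f : OrthonormalSeq) : Prop :=
  ∀ ξ : S, (∀ k, pair (incl ξ) (f k) = 0) → ξ = 0

theorem OrthonormalSeq.one_le_norm (f : OrthonormalSeq) (k q : ℕ) : 1 ≤ S.norm q (f k) := by
  have h0 : WSummable (-((0 : ℕ) : ℤ)) (incl (f k)) := (f k).2 0
  have h := norm_pair_le h0 (f k)
  rw [f.orthonormal, if_pos rfl, norm_one] at h
  have h1 : 1 ≤ wnorm ((0 : ℕ) : ℤ) (f k) := by
    by_contra hlt
    have h2 : wnorm (-((0 : ℕ) : ℤ)) (incl (f k)) = wnorm ((0 : ℕ) : ℤ) (f k) := rfl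
    rw [h2] at h
    nlinarith [wnorm_nonneg ((0 : ℕ) : ℤ) (f k)]
  exact h1.trans (wnorm_mono (by simp) ((f k).2 q))

/-! ### Köthe algebras -/

/-- A Köthe matrix `(a_{j,q})`. -/
structure KotheMatrix where
  entry : ℕ → ℕ → ℝ
  nonneg : ∀ j q, 0 ≤ entry j q
  exists_pos : ∀ j, ∃ q, 0 < entry j q
  mono : ∀ j q, entry j q ≤ entry j (q + 1)

/-- The sequence `ξ` belongs to `λ^∞(A)`: `sup_j |ξ_j| a_{j,q} < ∞` for all `q`. -/
def KotheMatrix.Mem (A : KotheMatrix) (ξ : ℕ → ℂ) : Prop :=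
  ∀ q, BddAbove (Set.range fun j => ‖ξ j‖ * A.entry j q)

/-- `λ^∞(A)` is closed under pointwise multiplication. -/
class KotheMatrix.IsAlgebra (A : KotheMatrix) : Prop where
  mul_mem : ∀ ξ η : ℕ → ℂ, A.Mem ξ → A.Mem η → A.Mem (ξ * η)

/-- The `*`-algebra underlying `λ^∞(A)`, with pointwise multiplication and conjugation. -/
def kotheSubalgebra (A : KotheMatrix) [A.IsAlgebra] : NonUnitalStarSubalgebra ℂ (ℕ → ℂ) where
  carrier := {ξ | A.Mem ξ}
  add_mem' := by
    intro ξ η hξ hη q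
    obtain ⟨B, hB⟩ := hξ q
    obtain ⟨C, hC⟩ := hη q
    refine ⟨B + C, ?_⟩
    rintro _ ⟨j, rfl⟩
    have h1 := hB ⟨j, rfl⟩
    have h2 := hC ⟨j, rfl⟩
    have h3 := mul_le_mul_of_nonneg_right (norm_add_le (ξ j) (η j)) (A.nonneg j q)
    simp only [Pi.add_apply] at *
    linarith
  zero_mem' q := ⟨0, by rintro _ ⟨j, rfl⟩; simp⟩
  smul_mem' := by
    intro c ξ hξ q
    obtain ⟨B, hB⟩ := hξ q
    refine ⟨‖c‖ * B, ?_⟩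
    rintro _ ⟨j, rfl⟩
    have h1 := mul_le_mul_of_nonneg_left (hB ⟨j, rfl⟩) (norm_nonneg c)
    simpa [mul_assoc] using h1
  mul_mem' := fun hξ hη => KotheMatrix.IsAlgebra.mul_mem _ _ hξ hη
  star_mem' := by
    intro ξ hξ q
    simpa using hξ q

/-- The Köthe algebra `λ^∞(A)`. -/
def LambdaInf (A : KotheMatrix) [A.IsAlgebra] : Type := kotheSubalgebra A

section LambdaInf

variable (A : KotheMatrix) [A.IsAlgebra]

instance : NonUnitalCommRing (LambdaInf A) :=
  inferInstanceAs (NonUnitalCommRing (kotheSubalgebra A))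
instance : Module ℂ (LambdaInf A) := inferInstanceAs (Module ℂ (kotheSubalgebra A))
instance : StarRing (LambdaInf A) := inferInstanceAs (StarRing (kotheSubalgebra A))

/-- The seminorm `|ξ|_{∞,q} = sup_j |ξ_j| a_{j,q}`. -/
def LambdaInf.norm (q : ℕ) : Seminorm ℂ (LambdaInf A) :=
  Seminorm.of (fun ξ : LambdaInf A => ⨆ j, ‖ξ.1 j‖ * A.entry j q)
    (fun ξ η => by
      refine ciSup_le fun j => ?_
      have h1 := le_ciSup (ξ.2 q) j
      have h2 := le_ciSup (η.2 q) j
      have h3 := mul_le_mul_of_nonneg_right (norm_add_le (ξ.1 j) (η.1 j)) (A.nonneg j q)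
      have h4 : (ξ + η).1 j = ξ.1 j + η.1 j := rfl
      rw [h4]
      linarith)
    (fun c ξ => by
      rw [Real.mul_iSup_of_nonneg (norm_nonneg c)]
      refine iSup_congr fun j => ?_
      have h4 : (c • ξ).1 j = c * ξ.1 j := rfl
      rw [h4, norm_mul, mul_assoc])

/-- The system of seminorms of `λ^∞(A)`. -/
def LambdaInf.norms : SeminormFamily ℂ (LambdaInf A) ℕ := LambdaInf.norm A

/-- The topology of `λ^∞(A)` is given by the seminorms `|·|_{∞,q}`. -/
instance : TopologicalSpace (LambdaInf A) := (LambdaInf.norms A).moduleFilterBasis.topology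

/-- The unit vector `e_k` of `λ^∞(A)`. -/
def LambdaInf.e (k : ℕ) : LambdaInf A :=
  ⟨Pi.single k 1, fun q => ⟨A.entry k q, by
    rintro _ ⟨j, rfl⟩
    by_cases h : j = k
    · subst h; simp
    · simpa [h] using A.nonneg k q⟩⟩

end LambdaInf

/-- The Köthe matrix `(|f_k|_q)_{k,q}`. -/
def OrthonormalSeq.matrix (f : OrthonormalSeq) : KotheMatrix where
  entry k q := S.norm q (f k)
  nonneg k q := apply_nonneg _ _
  exists_pos k := ⟨0, zero_lt_one.trans_le (f.one_le_norm k 0)⟩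
  mono k q := wnorm_mono (by simp) ((f k).2 (q + 1))

instance (f : OrthonormalSeq) : f.matrix.IsAlgebra where
  mul_mem ξ η hξ hη q := by
    obtain ⟨B, hB⟩ := hξ q
    obtain ⟨C, hC⟩ := hη q
    refine ⟨B * C, ?_⟩
    rintro _ ⟨k, rfl⟩
    have h1 : ‖ξ k‖ * S.norm q (f k) ≤ B := hB ⟨k, rfl⟩
    have h2 : ‖η k‖ * S.norm q (f k) ≤ C := hC ⟨k, rfl⟩
    have h3 := f.one_le_norm k q
    have h4 : ‖η k‖ ≤ C := le_trans (le_mul_of_one_le_right (norm_nonneg _) h3) h2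
    have h5 : 0 ≤ B := le_trans (by positivity) h1
    change ‖ξ k * η k‖ * S.norm q (f k) ≤ B * C
    rw [norm_mul]
    calc ‖ξ k‖ * ‖η k‖ * S.norm q (f k) = (‖ξ k‖ * S.norm q (f k)) * ‖η k‖ := by ring
      _ ≤ B * C := mul_le_mul h1 h4 (norm_nonneg _) h5

/-- `Φ` is an isomorphism of Fréchet `*`-algebras: a bijective `*`-homomorphism that is continuous
together with its inverse. -/
def IsFrechetIso {E : NonUnitalStarSubalgebra ℂ LSS} {A : KotheMatrix} [A.IsAlgebra]
    (Φ : E ≃⋆ₐ[ℂ] LambdaInf A) : Prop :=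
  Continuous Φ ∧ Continuous Φ.symm

end SmoothOp

end

open SmoothOp

/-!
The self-adjoint elements of a closed maximal commutative `*`-subalgebra `E` of `𝓛(s', s)` induce
commuting compact self-adjoint operators on `ℓ₂`. These have joint eigenvectors, which lie in `s`
because the operators map into `s`; by maximality the corresponding one-dimensional projections
belong to `E`, and no nonzero element of `s` is orthogonal to all of these eigenvectors, since its
own projection would belong to `E` as well. Hence the minimal projections of `E` are
`⟨·, f_k⟩ f_k` for an `s`-complete orthonormal sequence `(f_k)`.

For `s`-complete `(f_k)` an operator commuting with all `⟨·, f_k⟩ f_k` is determined by its diagonal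
entries `⟨x f_k, f_k⟩`, so the algebra of these operators is commutative and is the only maximal
commutative one that contains them. The diagonal entries of `x` lie in `λ^∞(|f_k|_q)` because
`x f_k = ⟨x f_k, f_k⟩ f_k` and `(f_k)` is bounded in `ℓ₂`. Conversely `∑ ξ_k ⟨·, f_k⟩ f_k` converges
for every `ξ ∈ λ^∞(|f_k|_q)`: the norms are log-convex, so a product of four of the numbers
`|f_k|_q` is at most a single one of higher index, and `∑ |f_k|_1⁻²` is finite.
-/

noncomputable section

namespace SmoothOp

open scoped Topology

/-! ### Weighted sequences and `ℓ₂` -/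

/-- The Hilbert space `ℓ₂` of square-summable sequences. -/
abbrev L2 : Type := lp (fun _ : ℕ => ℂ) 2

/-- The operator `(ξ_j) ↦ ((j+1)^q ξ_j)` on sequences. It shifts the scale of norms `wnorm` by `q`,
so that every level of the scale is a copy of `ℓ₂`. -/
def weight (q : ℤ) : (ℕ → ℂ) →ₗ[ℂ] ℕ → ℂ :=
  LinearMap.mulLeft ℂ fun j => ((((j : ℝ) + 1) ^ q : ℝ) : ℂ)

theorem weight_apply (q : ℤ) (ξ : ℕ → ℂ) (j : ℕ) :
    weight q ξ j = ((((j : ℝ) + 1) ^ q : ℝ) : ℂ) * ξ j := rfl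

theorem weight_zero (ξ : ℕ → ℂ) : weight 0 ξ = ξ := by
  ext j
  simp [weight_apply]

theorem weight_weight (q r : ℤ) (ξ : ℕ → ℂ) : weight q (weight r ξ) = weight (q + r) ξ := by
  ext j
  have hj : (j : ℝ) + 1 ≠ 0 := by positivity
  rw [weight_apply, weight_apply, weight_apply, zpow_add₀ hj, Complex.ofReal_mul, mul_assoc]

theorem norm_weight_apply (q : ℤ) (ξ : ℕ → ℂ) (j : ℕ) :
    ‖weight q ξ j‖ = ((j : ℝ) + 1) ^ q * ‖ξ j‖ := by
  rw [weight_apply, norm_mul, Complex.norm_of_nonneg (by positivity)]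

theorem weight_mul_conj (q : ℤ) (ξ η : ℕ → ℂ) (j : ℕ) :
    weight q ξ j * conj (η j) = ξ j * conj (weight q η j) := by
  rw [weight_apply, weight_apply, map_mul, Complex.conj_ofReal]
  ring

theorem norm_weight_sq_mul (p q : ℤ) (ξ : ℕ → ℂ) (j : ℕ) :
    ‖weight q ξ j‖ ^ 2 * ((j : ℝ) + 1) ^ (2 * p) = ‖ξ j‖ ^ 2 * ((j : ℝ) + 1) ^ (2 * (p + q)) := by
  have hj : (j : ℝ) + 1 ≠ 0 := by positivity
  rw [norm_weight_apply, mul_add, zpow_add₀ hj, mul_comm 2 q, zpow_mul _ q 2, zpow_ofNat]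
  ring

theorem wsummable_weight {p q : ℤ} {ξ : ℕ → ℂ} :
    WSummable p (weight q ξ) ↔ WSummable (p + q) ξ := by
  simp only [WSummable, norm_weight_sq_mul]

theorem wnorm_weight (p q : ℤ) (ξ : ℕ → ℂ) : wnorm p (weight q ξ) = wnorm (p + q) ξ := by
  simp only [wnorm, norm_weight_sq_mul]

theorem wnorm_sq (q : ℤ) (ξ : ℕ → ℂ) :
    wnorm q ξ ^ 2 = ∑' j : ℕ, ‖ξ j‖ ^ 2 * ((j : ℝ) + 1) ^ (2 * q) :=
  Real.sq_sqrt (tsum_nonneg fun _ => by positivity)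

theorem tsum_mul_conj_self (ξ : ℕ → ℂ) : ∑' j, ξ j * conj (ξ j) = (wnorm 0 ξ ^ 2 : ℝ) := by
  simp [wnorm_sq, Complex.ofReal_tsum, Complex.mul_conj']

/-- Cauchy–Schwarz: `|·|_{c-d}` and `|·|_{c+d}` are dual to each other with respect to the inner
product at level `c`. -/
theorem wnorm_sq_le_mul {c d : ℤ} {ξ : ℕ → ℂ} (h : WSummable (c - d) ξ)
    (h' : WSummable (c + d) ξ) : wnorm c ξ ^ 2 ≤ wnorm (c - d) ξ * wnorm (c + d) ξ := by
  have hle := norm_pairing_le (q := d) (wsummable_weight.2 (neg_add_eq_sub d c ▸ h))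
    (wsummable_weight.2 (add_comm c d ▸ h'))
  rw [tsum_mul_conj_self, Complex.norm_of_nonneg (by positivity), wnorm_weight, wnorm_weight,
    wnorm_weight, zero_add] at hle
  rwa [sub_eq_neg_add, add_comm c d]

theorem norm_coord_mul_le {q : ℤ} {ξ : ℕ → ℂ} (h : WSummable q ξ) (j : ℕ) :
    ‖ξ j‖ * ((j : ℝ) + 1) ^ q ≤ wnorm q ξ := by
  rw [mul_comm, ← norm_weight_apply, ← norm_toL2 q ξ h]
  exact lp.norm_apply_le_norm two_ne_zero (toL2 q ξ h) j

theorem wsummable_of_norm_le {q : ℤ} {D : ℝ} {ξ : ℕ → ℂ}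
    (h : ∀ j : ℕ, ‖ξ j‖ ≤ D * ((j : ℝ) + 1) ^ q) :
    WSummable (-(q + 1)) ξ ∧
      wnorm (-(q + 1)) ξ ≤ D * Real.sqrt (∑' j : ℕ, ((j : ℝ) + 1) ^ (-2 : ℤ)) := by
  have hζ : ∀ j : ℕ, ‖weight (-(q + 1)) ξ j‖ ≤ D * ((j : ℝ) + 1) ^ (-(((0 : ℕ) : ℤ) + 1)) := by
    intro j
    have hj : (j : ℝ) + 1 ≠ 0 := by positivity
    calc ‖weight (-(q + 1)) ξ j‖ ≤ ((j : ℝ) + 1) ^ (-(q + 1)) * (D * ((j : ℝ) + 1) ^ q) := by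
          rw [norm_weight_apply]
          gcongr
          exact h j
      _ = D * ((j : ℝ) + 1) ^ (-(((0 : ℕ) : ℤ) + 1)) := by
          rw [mul_left_comm, ← zpow_add₀ hj]
          congr 2
          push_cast
          ring
  obtain ⟨hw, hle⟩ := wsummable_of_bound hζ
  rw [wnorm_weight] at hle
  simpa using And.intro (wsummable_weight.1 hw) hle

theorem wsummable_coe (a : L2) : WSummable 0 a :=
  wsummable_of_memℓp (by simpa using lp.memℓp a)

theorem wnorm_coe (a : L2) : wnorm 0 a = ‖a‖ := by
  rw [← norm_toL2 0 a (wsummable_coe a)]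
  congr 1
  exact lp.ext (weight_zero a)

/-- `ξ ↦ ((j+1)^q ξ_j)` as a map `s → ℓ₂`, isometric for the norm `|·|_q`. -/
def S.toL2 (q : ℕ) : S →L[ℂ] L2 :=
  ⟨{ toFun := fun ξ => SmoothOp.toL2 q ξ (ξ.2 q)
     map_add' := fun ξ η => lp.ext (map_add (weight q) ξ.1 η.1)
     map_smul' := fun c ξ => lp.ext (LinearMap.map_smul (weight q) c ξ.1) },
    WithSeminorms.continuous_normedSpace_rng L2 S.withSeminorms _
      ⟨{q}, 1, fun ξ => by simpa using! (norm_toL2 q ξ (ξ.2 q)).le⟩⟩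

theorem S.coe_toL2 (q : ℕ) (ξ : S) : ⇑(S.toL2 q ξ) = weight q ξ := rfl

theorem S.norm_toL2 (q : ℕ) (ξ : S) : ‖S.toL2 q ξ‖ = S.norm q ξ :=
  SmoothOp.norm_toL2 q ξ (ξ.2 q)

/-- `a ↦ ((j+1)^q a_j)` as a map `ℓ₂ → s'`, isometric onto the step `{η : |η|'_q < ∞}`. -/
def ofL2 (q : ℕ) : L2 →L[ℂ] SDual :=
  ⟨{ toFun := fun a => ⟨weight q a, q, wsummable_weight.2 (by simpa using wsummable_coe a)⟩
     map_add' := fun a b => Subtype.ext (map_add (weight q) (a : ℕ → ℂ) b)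
     map_smul' := fun c a => Subtype.ext (LinearMap.map_smul (weight q) c (a : ℕ → ℂ)) },
    WithSeminorms.continuous_normedSpace_dom L2 SDual.withSeminorms _ fun p => by
      obtain ⟨C, hC⟩ := p.2 q
      refine ⟨C.toNNReal, fun a => ?_⟩
      have ha : wnorm (-q : ℤ) (weight q a) = ‖a‖ := by
        rw [wnorm_weight, neg_add_cancel, wnorm_coe]
      refine (hC ⟨weight q a, _⟩ (wsummable_weight.2 (by simpa using wsummable_coe a))).trans ?_
      rw [ha]
      exact mul_le_mul_of_nonneg_right (Real.le_coe_toNNReal C) (norm_nonneg a)⟩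

theorem coe_ofL2 (q : ℕ) (a : L2) : ⇑(ofL2 q a) = weight q a := rfl

theorem incl_eq_ofL2 (ξ : S) : incl ξ = ofL2 0 (S.toL2 0 ξ) := by
  refine Subtype.ext ?_
  rw [coe_ofL2, S.coe_toL2, weight_weight]
  exact (weight_zero _).symm

theorem exists_ofL2_eq {q : ℕ} {η : SDual} (hη : WSummable (-(q : ℤ)) η) :
    ∃ a, ofL2 q a = η ∧ ‖a‖ = wnorm (-(q : ℤ)) η := by
  refine ⟨SmoothOp.toL2 (-q) η hη, Subtype.ext ?_, norm_toL2 _ _ _⟩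
  change weight q (weight (-q) η) = η
  rw [weight_weight, add_neg_cancel, weight_zero]

theorem inner_toL2_left (q : ℕ) (ξ : S) (a : L2) :
    inner ℂ (S.toL2 q ξ) a = pair (ofL2 q a) ξ := by
  rw [lp.inner_eq_tsum]
  exact tsum_congr fun j => (weight_mul_conj q a ξ j).symm

theorem inner_toL2_toL2 (ξ η : S) : inner ℂ (S.toL2 0 ξ) (S.toL2 0 η) = pair (incl η) ξ := by
  rw [inner_toL2_left, incl_eq_ofL2]

theorem S.injective_toL2 : Function.Injective (S.toL2 0) := fun ξ η h => by
  refine Subtype.ext ?_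
  rw [← weight_zero ξ.1, ← weight_zero η.1]
  exact congrArg (fun a : L2 => (a : ℕ → ℂ)) h

/-! ### The pairing of `s'` and `s` -/

theorem pair_incl_self (ξ : S) : pair (incl ξ) ξ = (S.norm 0 ξ ^ 2 : ℝ) :=
  tsum_mul_conj_self ξ

theorem pair_incl_conj (ξ η : S) : conj (pair (incl ξ) η) = pair (incl η) ξ := by
  rw [← inner_toL2_toL2, ← inner_toL2_toL2, inner_conj_symm]

theorem pair_smul_right (η : SDual) (c : ℂ) (ξ : S) : pair η (c • ξ) = conj c * pair η ξ := by
  obtain ⟨q, hq⟩ := η.2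
  obtain ⟨a, rfl, -⟩ := exists_ofL2_eq hq
  rw [← inner_toL2_left, ← inner_toL2_left, map_smul, inner_smul_left]

theorem pair_add_right (η : SDual) (ξ ζ : S) : pair η (ξ + ζ) = pair η ξ + pair η ζ := by
  obtain ⟨q, hq⟩ := η.2
  obtain ⟨a, rfl, -⟩ := exists_ofL2_eq hq
  simp only [← inner_toL2_left, map_add, inner_add_left]

theorem pair_unitVec (i : ℕ) (ξ : S) : pair (unitVec i) ξ = conj (ξ i) := by
  rw [pair, tsum_eq_single i fun j hj => by simp [unitVec, hj]]
  simp [unitVec]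

/-- The functional `⟨·, ξ⟩` on `s'`. -/
def pairCLM (ξ : S) : SDual →L[ℂ] ℂ :=
  ⟨{ toFun := fun η => pair η ξ
     map_add' := fun η ζ => pair_add η ζ ξ
     map_smul' := fun c η => pair_smul c η ξ },
    WithSeminorms.continuous_of_continuous_comp (norm_withSeminorms ℂ ℂ) _ fun _ =>
      SDual.continuous_of_admissible fun q =>
        ⟨wnorm q ξ, fun _ hη => (norm_pair_le hη ξ).trans_eq (mul_comm _ _)⟩⟩

theorem pairCLM_apply (ξ : S) (η : SDual) : pairCLM ξ η = pair η ξ := rfl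

/-- The functional `ξ ↦ conj ⟨η, ξ⟩` on `s`. -/
def pairConjCLM (η : SDual) : S →L[ℂ] ℂ :=
  ⟨{ toFun := fun ξ => conj (pair η ξ)
     map_add' := fun ξ ζ => by rw [pair_add_right, map_add]
     map_smul' := fun c ξ => by simp [pair_smul_right] },
    WithSeminorms.continuous_normedSpace_rng ℂ S.withSeminorms _ <| by
      obtain ⟨q, hq⟩ := η.2
      refine ⟨{q}, ⟨wnorm (-q : ℤ) η, wnorm_nonneg _ _⟩, fun ξ => ?_⟩
      simpa using! norm_pair_le hq ξ⟩

theorem pairConjCLM_apply (η : SDual) (ξ : S) : pairConjCLM η ξ = conj (pair η ξ) := rfl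

theorem ofL2_single (q i : ℕ) (c : ℂ) :
    ofL2 q (lp.single 2 i c) = (((((i : ℝ) + 1) ^ (q : ℤ) : ℝ) : ℂ) * c) • unitVec i := by
  refine Subtype.ext (funext fun j => ?_)
  change weight q (lp.single 2 i c : L2) j = (_ * c) * (Pi.single i 1 : ℕ → ℂ) j
  rw [weight_apply]
  rcases eq_or_ne j i with rfl | hij
  · simp
  · simp [hij]

theorem SDual.clm_ext {F : Type*} [AddCommGroup F] [Module ℂ F] [TopologicalSpace F] [T2Space F]
    {T T' : SDual →L[ℂ] F} (h : ∀ i, T (unitVec i) = T' (unitVec i)) : T = T' := by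
  ext η
  obtain ⟨q, hq⟩ := η.2
  obtain ⟨a, rfl, -⟩ := exists_ofL2_eq hq
  refine DFunLike.congr_fun (f := T.comp (ofL2 q)) (g := T'.comp (ofL2 q)) ?_ a
  refine lp.ext_continuousLinearMap ENNReal.ofNat_ne_top fun i =>
    ContinuousLinearMap.ext fun c => ?_
  change T (ofL2 q (lp.single 2 i c)) = T' (ofL2 q (lp.single 2 i c))
  rw [ofL2_single, map_smul, map_smul, h]

/-! ### `s` is a Fréchet space -/

/-- The embedding `ξ ↦ (((j+1)^q ξ_j)_j)_q` of `s` into a countable product of Hilbert spaces. -/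
def S.toPi : S →L[ℂ] ℕ → L2 := ContinuousLinearMap.pi S.toL2

theorem S.isInducing_toPi : Topology.IsInducing S.toPi := by
  rw [IsTopologicalAddGroup.isInducing_iff_nhds_zero,
    S.norms.withSeminorms_iff_nhds_eq_iInf.1 S.withSeminorms, nhds_pi, Filter.pi,
    Filter.comap_iInf]
  refine iInf_congr fun q => ?_
  have hq : (S.norms q : S → ℝ) = (fun a : L2 => ‖a‖) ∘ S.toL2 q :=
    funext fun ξ => (S.norm_toL2 q ξ).symm
  rw [hq, ← Filter.comap_comap, comap_norm_nhds_zero, Filter.comap_comap]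
  rfl

theorem S.range_toPi :
    Set.range S.toPi = {a | ∀ q j : ℕ, a q j = ((((j : ℝ) + 1) ^ (q : ℤ) : ℝ) : ℂ) * a 0 j} := by
  refine Set.Subset.antisymm ?_ fun a ha => ?_
  · rintro _ ⟨ξ, rfl⟩ q j
    change weight q ξ j = _ * weight 0 ξ j
    rw [weight_zero, weight_apply]
  · have haq : ∀ q : ℕ, weight q (a 0) = a q := fun q => funext fun j => (ha q j).symm
    have hS : ∀ q : ℕ, WSummable q (a 0) := fun q => by
      rw [← zero_add (q : ℤ), ← wsummable_weight, haq]
      exact wsummable_coe (a q)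
    exact ⟨⟨a 0, hS⟩, funext fun q => lp.ext (haq q)⟩

theorem S.isClosedEmbedding_toPi : Topology.IsClosedEmbedding S.toPi := by
  refine ⟨⟨S.isInducing_toPi, fun ξ η h => S.injective_toL2 (congrFun h 0)⟩, ?_⟩
  have heval : ∀ q j : ℕ, Continuous fun a : ℕ → L2 => a q j := fun q j =>
    (lp.evalCLM ℂ (fun _ : ℕ => ℂ) 2 j).continuous.comp (continuous_apply q)
  simp only [S.range_toPi, Set.ofPred_forall]
  exact isClosed_iInter fun q => isClosed_iInter fun j =>
    isClosed_eq (heval q j) ((heval 0 j).const_mul _)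

instance : T2Space S := S.isClosedEmbedding_toPi.isEmbedding.t2Space

instance : TopologicalSpace.IsCompletelyMetrizableSpace S :=
  S.isClosedEmbedding_toPi.IsCompletelyMetrizableSpace

theorem S.sup_norms_le (t : Finset ℕ) : t.sup S.norms ≤ S.norm (t.sup id) :=
  Finset.sup_le fun _ hq ξ => wnorm_mono (by exact_mod_cast Finset.le_sup (f := id) hq) (ξ.2 _)

theorem S.summable_of_summable_norm {u : ℕ → S} (h : ∀ q, Summable fun k => S.norm q (u k)) :
    Summable u := by
  have hsum : Summable (S.toPi ∘ u) := Pi.summable.2 fun q =>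
    Summable.of_norm (by simpa [S.toPi, S.norm_toL2] using h q)
  obtain ⟨a, ha⟩ := hsum
  obtain ⟨ξ, rfl⟩ : a ∈ Set.range S.toPi :=
    S.isClosedEmbedding_toPi.isClosed_range.mem_of_tendsto ha <|
      Filter.Eventually.of_forall fun t => ⟨∑ k ∈ t, u k, map_sum S.toPi u t⟩
  exact ⟨ξ, (S.isInducing_toPi.hasSum_iff (g := S.toPi) u ξ).1 ha⟩

theorem S.norm_tsum_le {u : ℕ → S} (h : ∀ q, Summable fun k => S.norm q (u k)) (q : ℕ) :
    S.norm q (∑' k, u k) ≤ ∑' k, S.norm q (u k) := by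
  have hq := h q
  simp only [← S.norm_toL2] at hq ⊢
  rw [(S.toL2 q).map_tsum (S.summable_of_summable_norm h)]
  exact norm_tsum_le_tsum_norm hq

/-! ### Bounded subsets of `s'` -/

/-- A bounded subset of `s'` is bounded on `s` pointwise, hence, `s` being barrelled, equibounded
by a multiple of one norm `|·|_q`. -/
theorem SDual.exists_norm_pair_le {B : Set SDual} (hB : Bornology.IsVonNBounded ℂ B) :
    ∃ (q : ℕ) (C : ℝ), ∀ η ∈ B, ∀ ξ, ‖pair η ξ‖ ≤ C * S.norm q ξ := by
  let p : B → Seminorm ℂ S := fun η => (normSeminorm ℂ ℂ).comp (pairConjCLM η).toLinearMap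
  have hp : ∀ η ξ, p η ξ = ‖pair η ξ‖ := fun η ξ => by simp [p, pairConjCLM_apply]
  have hpc : ∀ η, Continuous (p η) := fun η => (pairConjCLM (η : SDual)).continuous.norm
  have hbdd : BddAbove (Set.range p) := Seminorm.bddAbove_range_iff.2 fun ξ => by
    obtain ⟨C, hC⟩ := ((NormedSpace.isVonNBounded_iff ℂ).1
      (hB.image (pairCLM ξ))).exists_norm_le
    exact ⟨C, by rintro _ ⟨η, rfl⟩; exact (hp η ξ).trans_le (hC _ ⟨η, η.2, rfl⟩)⟩
  have hcont : Continuous ⇑(⨆ η, p η : Seminorm ℂ S) := by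
    rw [Seminorm.coe_iSup_eq hbdd]
    exact Seminorm.continuous_iSup p hpc hbdd
  obtain ⟨t, C, -, hC⟩ := Seminorm.bound_of_continuous S.withSeminorms _ hcont
  refine ⟨t.sup id, C, fun η hη ξ => ?_⟩
  calc ‖pair η ξ‖ = p ⟨η, hη⟩ ξ := (hp ⟨η, hη⟩ ξ).symm
    _ ≤ (⨆ η, p η : Seminorm ℂ S) ξ := le_ciSup hbdd ⟨η, hη⟩ ξ
    _ ≤ C * t.sup S.norms ξ := hC ξ
    _ ≤ C * S.norm (t.sup id) ξ := mul_le_mul_of_nonneg_left (S.sup_norms_le t ξ) C.2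

/-- The unit vector `e_i` as an element of `s`. -/
def S.unitVec (i : ℕ) : S := ⟨SmoothOp.unitVec i, fun q => unitVec_wsummable q i⟩

theorem pair_unitVec_right (η : SDual) (i : ℕ) : pair η (S.unitVec i) = η i := by
  rw [pair, tsum_eq_single i fun j hj => by simp [S.unitVec, unitVec, hj]]
  simp [S.unitVec, unitVec]

theorem SDual.exists_wnorm_le {B : Set SDual} (hB : Bornology.IsVonNBounded ℂ B) :
    ∃ (q : ℕ) (C : ℝ), ∀ η ∈ B, WSummable (-(q : ℤ)) η ∧ wnorm (-(q : ℤ)) η ≤ C := by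
  obtain ⟨q, C, hC⟩ := SDual.exists_norm_pair_le hB
  refine ⟨q + 1, _, fun η hη => wsummable_of_norm_le (q := q) (D := C) fun i => ?_⟩
  rw [← pair_unitVec_right, ← wnorm_unitVec]
  exact hC η hη (S.unitVec i)

/-! ### The topological `*`-algebra `𝓛(s', s)` -/

theorem pair_star (x : LSS) (ξ η : SDual) : pair ξ (star x η) = conj (pair η (x ξ)) :=
  DFunLike.congr_fun (f := pairCLM (star x η)) (g := (pairConjCLM η).comp (x : SDual →L[ℂ] S))
    (SDual.clm_ext fun i => pair_unitVec i (star x η)) ξ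

theorem pair_incl_apply (x : LSS) (ξ : SDual) (η : S) :
    pair (incl (x ξ)) η = pair ξ (star x (incl η)) := by
  rw [pair_star, pair_incl_conj]

theorem eq_of_pair_unitVec_eq {ξ η : S} (h : ∀ i, pair (unitVec i) ξ = pair (unitVec i) η) :
    ξ = η :=
  Subtype.ext <| funext fun i => by
    simpa only [pair_unitVec, Complex.conj_conj] using congrArg conj (h i)

instance : StarRing LSS where
  star_involutive x := LSS.ext fun ξ => eq_of_pair_unitVec_eq fun i => by
    rw [pair_star, pair_star, Complex.conj_conj]
  star_mul x y := LSS.ext fun ξ => eq_of_pair_unitVec_eq fun i => by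
    rw [pair_star, LSS.mul_apply, LSS.mul_apply, pair_star, pair_incl_conj, ← pair_star]
  star_add x y := LSS.ext fun ξ =>
    Subtype.ext <| funext fun i => pair_add_right ξ (x (unitVec i)) (y (unitVec i))

instance : StarModule ℂ LSS where
  star_smul c x := LSS.ext fun ξ =>
    Subtype.ext <| funext fun i => pair_smul_right ξ c (x (unitVec i))

instance : IsScalarTower ℂ LSS LSS := ⟨fun _ _ _ => rfl⟩

instance : SMulCommClass ℂ LSS LSS :=
  ⟨fun c x y => LSS.ext fun ξ => (x.map_smul c (incl (y ξ))).symm⟩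

instance : IsTopologicalAddGroup LSS := inferInstanceAs (IsTopologicalAddGroup (SDual →L[ℂ] S))

instance : T2Space LSS := inferInstanceAs (T2Space (SDual →L[ℂ] S))

instance : IsSemitopologicalRing LSS where
  continuous_neg := continuous_neg
  continuous_const_mul {x} :=
    (ContinuousLinearMap.postcomp SDual ((x : SDual →L[ℂ] S).comp incl)).continuous
  continuous_mul_const {x} :=
    (ContinuousLinearMap.precomp S (incl.comp (x : SDual →L[ℂ] S))).continuous

/-! ### Maximal commutative subalgebras -/

/-- The bicommutant of `E ∪ {a}` is again closed and commutative. -/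
theorem IsClosedMaximalCommutative.mem_of_isSelfAdjoint {E : NonUnitalStarSubalgebra ℂ LSS}
    (hE : IsClosedMaximalCommutative E) {a : LSS} (ha : IsSelfAdjoint a)
    (hcomm : ∀ x ∈ E, x * a = a * x) : a ∈ E := by
  let s : Set LSS := {a} ∪ E
  have hs : star s = s := by
    rw [Set.union_star, Set.star_singleton, ha.star_eq, StarMemClass.star_coe_eq]
  have hs_comm : ∀ x ∈ s, ∀ y ∈ s, x * y = y * x := by
    rintro x (rfl | hx) y (rfl | hy)
    · rfl
    · exact (hcomm y hy).symm
    · exact hcomm x hx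
    · exact hE.1.2 x hx y hy
  let F := NonUnitalStarSubalgebra.centralizer ℂ
    (NonUnitalStarSubalgebra.centralizer ℂ s : Set LSS)
  have hF : (F : Set LSS) = s.centralizer.centralizer := by
    rw [NonUnitalStarSubalgebra.coe_centralizer_centralizer, hs, Set.union_self]
  have hsF : s ⊆ F := hF ▸ Set.subset_centralizer_centralizer
  have hFcc : IsClosedCommutative F := by
    refine ⟨hF ▸ Set.isClosed_centralizer _, fun x hx y hy => ?_⟩
    rw [← SetLike.mem_coe, hF] at hx hy
    exact Set.centralizer_centralizer_comm_of_comm hs_comm x hx y hy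
  exact hE.2 F hFcc (Set.subset_union_right.trans hsF) ▸ hsF (Set.mem_union_left _ rfl)

/-! ### One-dimensional operators -/

theorem rankOne_apply (f : S) (η : SDual) : rankOne f η = pair η f • f := rfl

theorem isSelfAdjoint_rankOne (f : S) : IsSelfAdjoint (rankOne f) :=
  LSS.ext fun ξ => eq_of_pair_unitVec_eq fun i => by
    rw [pair_star, rankOne_apply, rankOne_apply, pair_smul_right, pair_smul_right, map_mul,
      Complex.conj_conj, mul_comm]

/-- The functional `x ↦ ⟨x f, f⟩` on `𝓛(s', s)`. For `f = f_k` it is the `k`-th diagonal entry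
with respect to an orthonormal sequence `(f_k)`. -/
def diagCoeff (f : S) : LSS →ₗ[ℂ] ℂ where
  toFun x := pair (incl (x (incl f))) f
  map_add' x y := pair_add (incl (x (incl f))) (incl (y (incl f))) f
  map_smul' c x := pair_smul c (incl (x (incl f))) f

theorem diagCoeff_apply (f : S) (x : LSS) : diagCoeff f x = pair (incl (x (incl f))) f := rfl

theorem diagCoeff_star (f : S) (x : LSS) : diagCoeff f (star x) = conj (diagCoeff f x) := by
  rw [diagCoeff_apply, pair_incl_apply, star_star, ← pair_incl_conj, diagCoeff_apply]

theorem rankOne_mul_mul_rankOne (f : S) (x : LSS) :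
    rankOne f * x * rankOne f = diagCoeff f x • rankOne f :=
  LSS.ext fun η => by
    simp only [LSS.mul_apply, rankOne_apply, map_smul, LSS.map_smul]
    exact smul_comm (pair η f) (diagCoeff f x) f

section UnitVector

variable {f : S} (hf : pair (incl f) f = 1)

include hf

theorem rankOne_mul_rankOne : rankOne f * rankOne f = rankOne f :=
  LSS.ext fun η => by
    rw [LSS.mul_apply, rankOne_apply, rankOne_apply, map_smul, pair_smul, hf, mul_one]

theorem isStarProjection_rankOne : IsStarProjection (rankOne f) :=
  ⟨rankOne_mul_rankOne hf, isSelfAdjoint_rankOne f⟩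

theorem diagCoeff_rankOne : diagCoeff f (rankOne f) = 1 := by
  rw [diagCoeff_apply, rankOne_apply, hf, one_smul, hf]

theorem rankOne_ne_zero : rankOne f ≠ 0 := fun h => by
  simpa [h] using diagCoeff_rankOne hf

variable {x y : LSS} (hx : rankOne f * x = x * rankOne f)

include hx

theorem rankOne_mul_eq_smul : rankOne f * x = diagCoeff f x • rankOne f := by
  rw [← rankOne_mul_mul_rankOne, mul_assoc, ← hx, ← mul_assoc, rankOne_mul_rankOne hf]

theorem apply_incl_eq_smul : x (incl f) = diagCoeff f x • f := by
  have h := DFunLike.congr_fun (hx.symm.trans (rankOne_mul_eq_smul hf hx)) (incl f)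
  change x (incl (rankOne f (incl f))) = diagCoeff f x • rankOne f (incl f) at h
  rwa [rankOne_apply, hf, one_smul] at h

theorem pair_incl_apply_eq_mul (η : SDual) :
    pair (incl (x η)) f = diagCoeff f x * pair η f := by
  have h := congrArg (fun z : LSS => pair (incl (z η)) f) (rankOne_mul_eq_smul hf hx)
  change pair (incl (rankOne f (incl (x η)))) f = pair (incl (diagCoeff f x • rankOne f η)) f at h
  simpa only [rankOne_apply, map_smul, pair_smul, hf, mul_one] using h

theorem diagCoeff_mul : diagCoeff f (x * y) = diagCoeff f x * diagCoeff f y :=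
  pair_incl_apply_eq_mul hf hx (incl (y (incl f)))

end UnitVector

theorem mul_rankOne_eq_smul {f : S} {x : LSS} {c : ℂ} (h : x (incl f) = c • f) :
    x * rankOne f = c • rankOne f :=
  LSS.ext fun η => by
    change x (incl (pair η f • f)) = c • pair η f • f
    rw [map_smul, LSS.map_smul, h, smul_comm]

/-! ### Norms of orthonormal sequences -/

theorem S.norm_mono {q r : ℕ} (h : q ≤ r) (ξ : S) : S.norm q ξ ≤ S.norm r ξ :=
  wnorm_mono (by exact_mod_cast h) (ξ.2 r)

theorem S.norm_sq_le_mul (q : ℕ) (ξ : S) :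
    S.norm q ξ ^ 2 ≤ S.norm 0 ξ * S.norm (2 * q) ξ := by
  have h := wnorm_sq_le_mul (c := q) (d := q) (by simpa using ξ.2 0)
    (by simpa [two_mul] using ξ.2 (2 * q))
  rw [sub_self, ← two_mul] at h
  exact_mod_cast h

theorem S.norm_pow_four_le {ξ : S} (hξ : S.norm 0 ξ = 1) (q : ℕ) :
    S.norm q ξ ^ 4 ≤ S.norm (4 * q) ξ := by
  have hle : ∀ r, S.norm r ξ ^ 2 ≤ S.norm (2 * r) ξ := fun r => by
    simpa only [hξ, one_mul] using S.norm_sq_le_mul r ξ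
  calc S.norm q ξ ^ 4 = (S.norm q ξ ^ 2) ^ 2 := by ring
    _ ≤ S.norm (2 * q) ξ ^ 2 := by gcongr; exact hle q
    _ ≤ S.norm (2 * (2 * q)) ξ := hle (2 * q)
    _ = S.norm (4 * q) ξ := by congr 2; ring

theorem incl_unitVec (i : ℕ) : incl (S.unitVec i) = unitVec i := rfl

theorem S.norm_zero_eq_one {ξ : S} (h : pair (incl ξ) ξ = 1) : S.norm 0 ξ = 1 := by
  rw [pair_incl_self] at h
  exact (pow_eq_one_iff_of_nonneg (apply_nonneg _ _) two_ne_zero).1 (by exact_mod_cast h)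

namespace OrthonormalSeq

variable (f : OrthonormalSeq)

theorem pair_self (k : ℕ) : pair (incl (f k)) (f k) = 1 := by rw [f.orthonormal, if_pos rfl]

theorem orthonormal_toL2 : Orthonormal ℂ fun k => S.toL2 0 (f k) :=
  orthonormal_iff_ite.2 fun k l => by simp only [inner_toL2_toL2, f.orthonormal, eq_comm]

theorem sum_norm_coord_sq_le_one (t : Finset ℕ) (j : ℕ) : ∑ k ∈ t, ‖f k j‖ ^ 2 ≤ 1 := by
  have hj : pair (incl (S.unitVec j)) (S.unitVec j) = 1 := by
    rw [pair_unitVec_right, incl_unitVec]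
    simp [unitVec]
  have h := f.orthonormal_toL2.sum_inner_products_le (S.toL2 0 (S.unitVec j)) (s := t)
  rw [S.norm_toL2, S.norm_zero_eq_one hj, one_pow] at h
  simpa [inner_toL2_toL2, incl_unitVec, pair_unitVec] using h

/-- Summing `|f_k|_{-1}²` over `k` first, Bessel's inequality for the unit vectors bounds the sum
by `∑ j^{-2}`; and `|f_k|_{-1} |f_k|_1 ≥ |f_k|_0² = 1`. -/
theorem summable_inv_norm_sq : Summable fun k => (S.norm 1 (f k) ^ 2)⁻¹ := by
  have hws : ∀ k, WSummable (-1) (f k) := fun k => ((f k).2 0).mono (by simp)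
  have hsum : Summable fun k => wnorm (-1) (f k) ^ 2 := by
    refine summable_of_sum_le (c := ∑' j : ℕ, ((j : ℝ) + 1) ^ (-2 : ℤ)) (fun k => by positivity)
      fun t => ?_
    simp only [wnorm_sq]
    rw [← Summable.tsum_finsetSum fun k _ => hws k]
    refine (summable_sum fun k _ => hws k).tsum_le_tsum (fun j => ?_) summable_inv_sq
    rw [← Finset.sum_mul]
    exact mul_le_of_le_one_left (by positivity) (f.sum_norm_coord_sq_le_one t j)
  refine Summable.of_nonneg_of_le (fun k => by positivity) (fun k => ?_) hsum
  have h0 : wnorm 0 (f k) = 1 := S.norm_zero_eq_one (f.pair_self k)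
  have hmul : 1 ≤ wnorm (-1) (f k) * wnorm 1 (f k) := by
    simpa [h0] using wnorm_sq_le_mul (c := 0) (d := 1) (by simpa using hws k) ((f k).2 1)
  rw [inv_le_iff_one_le_mul₀ (by have := f.one_le_norm k 1; positivity), ← mul_pow]
  exact one_le_pow₀ hmul

theorem norm_mul_norm_le (k q r : ℕ) :
    S.norm r (f k) * S.norm q (f k) ≤
      S.norm (4 * (q + r + 1)) (f k) * (S.norm 1 (f k) ^ 2)⁻¹ := by
  have hpos : 0 < S.norm 1 (f k) := zero_lt_one.trans_le (f.one_le_norm k 1)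
  rw [← div_eq_mul_inv, le_div_iff₀ (by positivity)]
  set m := q + r + 1
  calc S.norm r (f k) * S.norm q (f k) * S.norm 1 (f k) ^ 2
      ≤ S.norm m (f k) * S.norm m (f k) * S.norm m (f k) ^ 2 := by
        gcongr <;> exact S.norm_mono (by lia) (f k)
    _ = S.norm m (f k) ^ 4 := by ring
    _ ≤ S.norm (4 * m) (f k) := S.norm_pow_four_le (S.norm_zero_eq_one (f.pair_self k)) m

theorem IsSComplete.ext {f : OrthonormalSeq} (hf : f.IsSComplete) {ξ η : S}
    (h : ∀ k, pair (incl ξ) (f k) = pair (incl η) (f k)) : ξ = η :=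
  sub_eq_zero.1 <| hf _ fun k => by
    rw [← sub_eq_zero.2 (h k)]
    exact map_sub (pairCLM (f k) ∘L incl) ξ η

end OrthonormalSeq

/-! ### Diagonal operators -/

section Diagonal

variable {f : OrthonormalSeq}

theorem LambdaInf.withSeminorms (A : KotheMatrix) [A.IsAlgebra] :
    WithSeminorms (LambdaInf.norms A) := ⟨rfl⟩

theorem LambdaInf.norm_mul_le {A : KotheMatrix} [A.IsAlgebra] (ξ : LambdaInf A) (k q : ℕ) :
    ‖ξ.1 k‖ * A.entry k q ≤ LambdaInf.norm A q ξ :=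
  le_ciSup (ξ.2 q) k

theorem norm_diag_term_le (ξ : LambdaInf f.matrix) (q : ℕ) {r : ℕ} {η : SDual}
    (hη : WSummable (-(r : ℤ)) η) (k : ℕ) :
    S.norm q ((ξ.1 k * pair η (f k)) • f k) ≤
      LambdaInf.norm f.matrix (4 * (q + r + 1)) ξ * wnorm (-(r : ℤ)) η *
        (S.norm 1 (f k) ^ 2)⁻¹ := by
  have hw := wnorm_nonneg (-(r : ℤ)) η
  rw [map_smul_eq_mul, norm_mul]
  calc ‖ξ.1 k‖ * ‖pair η (f k)‖ * S.norm q (f k)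
      ≤ ‖ξ.1 k‖ * (wnorm (-(r : ℤ)) η * S.norm r (f k)) * S.norm q (f k) := by
        gcongr
        exact norm_pair_le hη (f k)
    _ = ‖ξ.1 k‖ * wnorm (-(r : ℤ)) η * (S.norm r (f k) * S.norm q (f k)) := by ring
    _ ≤ ‖ξ.1 k‖ * wnorm (-(r : ℤ)) η *
          (S.norm (4 * (q + r + 1)) (f k) * (S.norm 1 (f k) ^ 2)⁻¹) := by
        exact mul_le_mul_of_nonneg_left (f.norm_mul_norm_le k q r) (by positivity)
    _ = ‖ξ.1 k‖ * S.norm (4 * (q + r + 1)) (f k) * wnorm (-(r : ℤ)) η *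
          (S.norm 1 (f k) ^ 2)⁻¹ := by ring
    _ ≤ _ := by
        gcongr
        exact ξ.norm_mul_le k (4 * (q + r + 1))

theorem summable_norm_diag (ξ : LambdaInf f.matrix) (η : SDual) (q : ℕ) :
    Summable fun k => S.norm q ((ξ.1 k * pair η (f k)) • f k) := by
  obtain ⟨r, hr⟩ := η.2
  exact Summable.of_nonneg_of_le (fun k => apply_nonneg _ _) (norm_diag_term_le ξ q hr)
    (f.summable_inv_norm_sq.mul_left _)

theorem norm_tsum_diag_le (ξ : LambdaInf f.matrix) (q : ℕ) {r : ℕ} {η : SDual}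
    (hη : WSummable (-(r : ℤ)) η) :
    S.norm q (∑' k, (ξ.1 k * pair η (f k)) • f k) ≤
      LambdaInf.norm f.matrix (4 * (q + r + 1)) ξ * wnorm (-(r : ℤ)) η *
        ∑' k, (S.norm 1 (f k) ^ 2)⁻¹ := by
  refine (S.norm_tsum_le (summable_norm_diag ξ η) q).trans ?_
  rw [← tsum_mul_left]
  exact (summable_norm_diag ξ η q).tsum_le_tsum (norm_diag_term_le ξ q hη)
    (f.summable_inv_norm_sq.mul_left _)

theorem summable_diag (ξ : LambdaInf f.matrix) (η : SDual) :
    Summable fun k => (ξ.1 k * pair η (f k)) • f k :=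
  S.summable_of_summable_norm (summable_norm_diag ξ η)

/-- The operator `∑ ξ_k ⟨·, f_k⟩ f_k` with diagonal entries `ξ ∈ λ^∞(|f_k|_q)`. -/
def diag (ξ : LambdaInf f.matrix) : LSS :=
  SDual.mkCLM
    { toFun := fun η => ∑' k, (ξ.1 k * pair η (f k)) • f k
      map_add' := fun η ζ => by
        simp only [pair_add, mul_add, add_smul]
        exact (summable_diag ξ η).tsum_add (summable_diag ξ ζ)
      map_smul' := fun c η => by
        simp only [pair_smul, mul_left_comm, mul_smul c, RingHom.id_apply]
        exact (summable_diag ξ η).tsum_const_smul c }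
    fun q r => ⟨LambdaInf.norm f.matrix (4 * (q + r + 1)) ξ * ∑' k, (S.norm 1 (f k) ^ 2)⁻¹,
      fun _ hη => (norm_tsum_diag_le ξ q hη).trans_eq (mul_right_comm _ _ _)⟩

theorem diag_apply (ξ : LambdaInf f.matrix) (η : SDual) :
    diag ξ η = ∑' k, (ξ.1 k * pair η (f k)) • f k := rfl

theorem diag_apply_incl (ξ : LambdaInf f.matrix) (l : ℕ) : diag ξ (incl (f l)) = ξ.1 l • f l := by
  rw [diag_apply, tsum_eq_single l fun k hk => by simp [f.orthonormal, hk.symm], f.pair_self,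
    mul_one]

theorem pair_incl_diag (ξ : LambdaInf f.matrix) (η : SDual) (l : ℕ) :
    pair (incl (diag ξ η)) (f l) = ξ.1 l * pair η (f l) := by
  have h := (pairCLM (f l) ∘L incl).map_tsum (summable_diag ξ η)
  refine h.trans ?_
  rw [tsum_eq_single l fun k hk => by simp [pairCLM_apply, f.orthonormal, hk]]
  simp [pairCLM_apply, f.pair_self]

theorem diagCoeff_diag (ξ : LambdaInf f.matrix) (k : ℕ) : diagCoeff (f k) (diag ξ) = ξ.1 k := by
  rw [diagCoeff_apply, pair_incl_diag, f.pair_self, mul_one]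

/-! ### The algebra of diagonal operators -/

/-- The algebra of the operators that are diagonal with respect to `(f_k)`, encoded as the
commutant of the projections `⟨·, f_k⟩ f_k`. -/
def diagSubalgebra (f : OrthonormalSeq) : NonUnitalStarSubalgebra ℂ LSS :=
  NonUnitalStarSubalgebra.centralizer ℂ (Set.range fun k => rankOne (f k))

theorem mem_diagSubalgebra {x : LSS} :
    x ∈ diagSubalgebra f ↔ ∀ k, rankOne (f k) * x = x * rankOne (f k) := by
  simp only [diagSubalgebra, NonUnitalStarSubalgebra.mem_centralizer_iff, Set.forall_mem_range,
    (isSelfAdjoint_rankOne _).star_eq, and_self]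

theorem rankOne_mul_rankOne_of_orthogonal {g h : S} (hgh : pair (incl h) g = 0) :
    rankOne g * rankOne h = 0 :=
  LSS.ext fun η => by
    rw [LSS.mul_apply, rankOne_apply, rankOne_apply, map_smul, pair_smul, hgh, mul_zero, zero_smul]
    rfl

theorem rankOne_mem_diagSubalgebra (f : OrthonormalSeq) (k : ℕ) :
    rankOne (f k) ∈ diagSubalgebra f :=
  mem_diagSubalgebra.2 fun l => by
    rcases eq_or_ne k l with rfl | hkl
    · rfl
    · rw [rankOne_mul_rankOne_of_orthogonal (by rw [f.orthonormal, if_neg hkl]),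
        rankOne_mul_rankOne_of_orthogonal (by rw [f.orthonormal, if_neg hkl.symm])]

theorem pair_apply_of_mem_diagSubalgebra {x : LSS} (hx : x ∈ diagSubalgebra f) (η : SDual)
    (k : ℕ) : pair (incl (x η)) (f k) = diagCoeff (f k) x * pair η (f k) :=
  pair_incl_apply_eq_mul (f.pair_self k) (mem_diagSubalgebra.1 hx k) η

theorem diag_mem_diagSubalgebra (ξ : LambdaInf f.matrix) : diag ξ ∈ diagSubalgebra f :=
  mem_diagSubalgebra.2 fun k => LSS.ext fun η => by
    rw [LSS.mul_apply, LSS.mul_apply, rankOne_apply, rankOne_apply, map_smul, LSS.map_smul,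
      pair_incl_diag, diag_apply_incl, mul_comm, mul_smul]

theorem isClosedCommutative_diagSubalgebra (hf : f.IsSComplete) :
    IsClosedCommutative (diagSubalgebra f) := by
  refine ⟨Set.isClosed_centralizer _, fun x hx y hy => LSS.ext fun η => hf.ext fun k => ?_⟩
  simp only [LSS.mul_apply, pair_apply_of_mem_diagSubalgebra hx,
    pair_apply_of_mem_diagSubalgebra hy]
  exact mul_left_comm _ _ _

theorem le_diagSubalgebra {E : NonUnitalStarSubalgebra ℂ LSS}
    (hE : ∀ x ∈ E, ∀ y ∈ E, x * y = y * x) (hP : ∀ k, rankOne (f k) ∈ E) :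
    E ≤ diagSubalgebra f := fun _ hx =>
  mem_diagSubalgebra.2 fun k => hE _ (hP k) _ hx

theorem isClosedMaximalCommutative_diagSubalgebra (hf : f.IsSComplete) :
    IsClosedMaximalCommutative (diagSubalgebra f) :=
  ⟨isClosedCommutative_diagSubalgebra hf, fun _ hF hle =>
    (le_diagSubalgebra hF.2 fun k => hle (rankOne_mem_diagSubalgebra f k)).antisymm hle⟩

theorem IsClosedMaximalCommutative.eq_diagSubalgebra {E : NonUnitalStarSubalgebra ℂ LSS}
    (hE : IsClosedMaximalCommutative E) (hf : f.IsSComplete) (hP : ∀ k, rankOne (f k) ∈ E) :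
    E = diagSubalgebra f :=
  (hE.2 _ (isClosedCommutative_diagSubalgebra hf) (le_diagSubalgebra hE.1.2 hP)).symm

theorem norm_diagCoeff_mul {x : LSS} (hx : x ∈ diagSubalgebra f) (k q : ℕ) :
    ‖diagCoeff (f k) x‖ * S.norm q (f k) = S.norm q (x (incl (f k))) := by
  rw [apply_incl_eq_smul (f.pair_self k) (mem_diagSubalgebra.1 hx k), map_smul_eq_mul]

theorem mem_matrix_diagCoeff {x : LSS} (hx : x ∈ diagSubalgebra f) :
    f.matrix.Mem fun k => diagCoeff (f k) x := fun q => by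
  obtain ⟨C, hC⟩ := SDual.exists_bound x q 0
  refine ⟨C, ?_⟩
  rintro _ ⟨k, rfl⟩
  have hk : wnorm (-((0 : ℕ) : ℤ)) (incl (f k)) = 1 := S.norm_zero_eq_one (f.pair_self k)
  refine (norm_diagCoeff_mul hx k q).trans_le ((hC (incl (f k)) ((f k).2 0)).trans_eq ?_)
  rw [hk, mul_one]

/-- The isomorphism of the algebra of diagonal operators onto `λ^∞(|f_k|_q)`, sending an operator
to the sequence of its diagonal entries. -/
def diagEquiv (hf : f.IsSComplete) : diagSubalgebra f ≃⋆ₐ[ℂ] LambdaInf f.matrix where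
  toFun x := ⟨fun k => diagCoeff (f k) x.1, mem_matrix_diagCoeff x.2⟩
  invFun ξ := ⟨diag ξ, diag_mem_diagSubalgebra ξ⟩
  left_inv x := Subtype.ext <| LSS.ext fun η => hf.ext fun k =>
    (pair_incl_diag _ η k).trans (pair_apply_of_mem_diagSubalgebra x.2 η k).symm
  right_inv ξ := Subtype.ext <| funext (diagCoeff_diag ξ)
  map_mul' x _ := Subtype.ext <| funext fun k =>
    diagCoeff_mul (f.pair_self k) (mem_diagSubalgebra.1 x.2 k)
  map_add' x y := Subtype.ext <| funext fun k => map_add (diagCoeff (f k)) x.1 y.1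
  map_star' x := Subtype.ext <| funext fun k => diagCoeff_star (f k) x.1
  map_smul' c x := Subtype.ext <| funext fun k => map_smul (diagCoeff (f k)) c x.1

theorem diagEquiv_rankOne (hf : f.IsSComplete) (k : ℕ) :
    diagEquiv hf ⟨rankOne (f k), rankOne_mem_diagSubalgebra f k⟩ = LambdaInf.e f.matrix k := by
  refine Subtype.ext <| funext fun l => ?_
  change diagCoeff (f l) (rankOne (f k)) = (Pi.single k 1 : ℕ → ℂ) l
  rw [diagCoeff_apply, rankOne_apply, map_smul, pair_smul, f.orthonormal, f.orthonormal]
  rcases eq_or_ne l k with rfl | hlk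
  · simp
  · simp [hlk]

theorem eq_diagEquiv (hf : f.IsSComplete) {Φ : diagSubalgebra f ≃⋆ₐ[ℂ] LambdaInf f.matrix}
    (hΦ : ∀ k, Φ ⟨rankOne (f k), rankOne_mem_diagSubalgebra f k⟩ = LambdaInf.e f.matrix k) :
    Φ = diagEquiv hf := by
  refine StarAlgEquiv.ext fun x => Subtype.ext <| funext fun k => ?_
  let P : diagSubalgebra f := ⟨rankOne (f k), rankOne_mem_diagSubalgebra f k⟩
  have hP : P * x = diagCoeff (f k) x.1 • P :=
    Subtype.ext (rankOne_mul_eq_smul (f.pair_self k) (mem_diagSubalgebra.1 x.2 k))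
  have hk := congrArg (fun ξ : LambdaInf f.matrix => ξ.1 k) (congrArg Φ hP)
  simp only [map_mul, map_smul, P, hΦ] at hk
  change (Pi.single k 1 : ℕ → ℂ) k * (Φ x).1 k = diagCoeff (f k) x.1 * (Pi.single k 1 : ℕ → ℂ) k
    at hk
  rwa [Pi.single_eq_same, one_mul, mul_one] at hk

/-! ### Continuity of the isomorphism -/

theorem isVonNBounded_range_incl (f : OrthonormalSeq) :
    Bornology.IsVonNBounded ℂ (Set.range fun k => incl (f k)) := by
  refine ((NormedSpace.isVonNBounded_closedBall ℂ L2 1).image (ofL2 0)).subset ?_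
  rintro _ ⟨k, rfl⟩
  exact ⟨S.toL2 0 (f k), by simp [S.norm_toL2, S.norm_zero_eq_one (f.pair_self k)],
    (incl_eq_ofL2 (f k)).symm⟩

theorem continuous_diagEquiv (hf : f.IsSComplete) : Continuous (diagEquiv hf) := by
  have : IsTopologicalAddGroup (LambdaInf f.matrix) :=
    (LambdaInf.withSeminorms f.matrix).topologicalAddGroup
  refine continuous_of_continuousAt_zero (diagEquiv hf) ?_
  rw [ContinuousAt, map_zero]
  refine ((LambdaInf.withSeminorms f.matrix).tendsto_nhds _ _).2 fun q ε hε => ?_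
  have hU : Seminorm.ball (S.norm q) 0 (ε / 2) ∈ 𝓝 0 :=
    S.withSeminorms.mem_nhds_iff 0 _ |>.2 ⟨{q}, ε / 2, half_pos hε, by simp [S.norms]⟩
  have hev : ∀ᶠ x : LSS in 𝓝 0, Set.MapsTo x (Set.range fun k => incl (f k))
      (Seminorm.ball (S.norm q) 0 (ε / 2)) :=
    ContinuousLinearMap.eventually_nhds_zero_mapsTo (F := S) (isVonNBounded_range_incl f) hU
  filter_upwards [continuousAt_subtype_val.eventually hev] with x hx
  rw [sub_zero]
  refine (ciSup_le fun k => ?_).trans_lt (half_lt_self hε)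
  have hk := hx ⟨k, rfl⟩
  rw [Seminorm.mem_ball_zero] at hk
  exact (norm_diagCoeff_mul x.2 k q).trans_le hk.le

theorem eventually_norm_diag_lt (f : OrthonormalSeq) {B : Set SDual}
    (hB : Bornology.IsVonNBounded ℂ B) (q : ℕ) {ε : ℝ} (hε : 0 < ε) :
    ∀ᶠ ξ : LambdaInf f.matrix in 𝓝 0, ∀ η ∈ B, S.norm q (diag ξ η) < ε := by
  obtain ⟨r, C, hC⟩ := SDual.exists_wnorm_le hB
  have hcont : Continuous fun ξ : LambdaInf f.matrix =>
      LambdaInf.norm f.matrix (4 * (q + r + 1)) ξ * |C| * ∑' k, (S.norm 1 (f k) ^ 2)⁻¹ :=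
    (((LambdaInf.withSeminorms f.matrix).continuous_seminorm _).mul_const _).mul_const _
  filter_upwards [hcont.continuousAt.eventually_lt continuousAt_const (by simpa using hε)]
    with ξ hξ η hη
  refine ((norm_tsum_diag_le ξ q (hC η hη).1).trans ?_).trans_lt hξ
  gcongr
  exact (hC η hη).2.trans (le_abs_self C)

theorem continuous_diagEquiv_symm (hf : f.IsSComplete) : Continuous (diagEquiv hf).symm := by
  have : IsTopologicalAddGroup (LambdaInf f.matrix) :=
    (LambdaInf.withSeminorms f.matrix).topologicalAddGroup
  refine continuous_of_continuousAt_zero (diagEquiv hf).symm ?_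
  rw [Topology.IsInducing.subtypeVal.continuousAt_iff, ContinuousAt, Function.comp_apply, map_zero]
  refine (ContinuousLinearMap.hasBasis_nhds_zero_of_basis (σ := RingHom.id ℂ) (E := SDual) (F := S)
    S.withSeminorms.hasBasis_zero_ball).tendsto_right_iff.2 ?_
  rintro ⟨B, t, ε⟩ ⟨hB, hε⟩
  filter_upwards [eventually_norm_diag_lt f hB (t.sup id) hε] with ξ hξ η hη
  rw [Seminorm.mem_ball_zero]
  exact (S.sup_norms_le t _).trans_lt (hξ η hη)

theorem isFrechetIso_diagEquiv (hf : f.IsSComplete) : IsFrechetIso (diagEquiv hf) :=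
  ⟨continuous_diagEquiv hf, continuous_diagEquiv_symm hf⟩

end Diagonal

/-! ### Compact operators and joint eigenvectors -/

theorem isCompactOperator_of_norm_apply_le {𝕜 V ι : Type*} [NontriviallyNormedField 𝕜]
    [NormedAddCommGroup V] [NormedSpace 𝕜 V] {F : ι → Type*} [∀ i, NormedAddCommGroup (F i)]
    [∀ i, NormedSpace 𝕜 (F i)] [∀ i, CompleteSpace (F i)] [∀ i, LocallyCompactSpace (F i)]
    {p : ENNReal} [Fact (1 ≤ p)] (hp : p ≠ ⊤) {T : V →L[𝕜] lp F p} {c : ι → ℝ} (hc : Summable c)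
    (hT : ∀ a i, ‖T a i‖ ≤ c i * ‖a‖) : IsCompactOperator T := by
  classical
  let coord (i : ι) : V →L[𝕜] F i := (lp.evalCLM 𝕜 F p i).comp T
  let P (i : ι) : V →L[𝕜] lp F p := (lp.singleContinuousLinearMap 𝕜 F p i).comp (coord i)
  have hP : Summable P := by
    refine Summable.of_norm_bounded hc.abs fun i =>
      ContinuousLinearMap.opNorm_le_bound _ (abs_nonneg _) fun a => ?_
    calc ‖P i a‖ = ‖T a i‖ := lp.norm_single (zero_lt_one.trans_le Fact.out) _ _
      _ ≤ |c i| * ‖a‖ := (hT a i).trans (by gcongr; exact le_abs_self _)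
  have hsum : HasSum P T := by
    convert! hP.hasSum using 1
    ext1 a
    exact (lp.hasSum_single hp (T a)).unique (hP.hasSum.mapL (ContinuousLinearMap.apply 𝕜 _ a))
  refine isCompactOperator_of_tendsto hsum (Filter.Eventually.of_forall fun s => ?_)
  have hs : ∑ i ∈ s, P i ∈ compactOperator (RingHom.id 𝕜) V (lp F p) := sum_mem fun i _ =>
    (isCompactOperator_of_locallyCompactSpace_rng
      (lp.singleContinuousLinearMap 𝕜 F p i)).comp_clm (coord i)
  exact hs

theorem exists_joint_eigenvector {𝕜 K ι : Type*} [RCLike 𝕜] [NormedAddCommGroup K]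
    [InnerProductSpace 𝕜 K] [CompleteSpace K] {T : ι → K →L[𝕜] K}
    (hT : ∀ i, (T i : K →ₗ[𝕜] K).IsSymmetric) (hcomm : ∀ i j, Commute (T i) (T j)) {i₀ : ι}
    (hc : IsCompactOperator (T i₀)) (h0 : T i₀ ≠ 0) :
    ∃ a, T i₀ a ≠ 0 ∧ ∀ i, ∃ c : 𝕜, T i a = c • a := by
  obtain ⟨μ, hμ, hμ0⟩ :
      ∃ μ, Module.End.HasEigenvalue (T i₀ : Module.End 𝕜 K) μ ∧ μ ≠ 0 := by
    by_contra! h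
    exact h0 ((ContinuousLinearMap.eq_zero_of_forall_hasEigenvalue_eq_zero hc (hT i₀)).1 h)
  let V := Module.End.eigenspace (T i₀ : Module.End 𝕜 K) μ
  have : FiniteDimensional 𝕜 V := ContinuousLinearMap.finite_dimensional_eigenspace hc μ hμ0
  have : Nontrivial V := Submodule.nontrivial_iff_ne_bot.2 hμ
  have hV : ∀ i, ∀ a ∈ V, T i a ∈ V := fun i a ha => by
    rw [Module.End.mem_eigenspace_iff] at ha ⊢
    have h := DFunLike.congr_fun (hcomm i₀ i) a
    change T i₀ (T i a) = T i (T i₀ a) at h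
    change T i₀ a = μ • a at ha
    rw [ContinuousLinearMap.coe_coe, h, ha, map_smul]
  let R (i : ι) : V →ₗ[𝕜] V := (T i : K →ₗ[𝕜] K).restrict (hV i)
  have hR : ⨆ χ : ι → 𝕜, ⨅ i, Module.End.eigenspace (R i) (χ i) = ⊤ :=
    LinearMap.IsSymmetric.iSup_iInf_eq_top_of_commute (fun i => (hT i).restrict_invariant (hV i))
      fun i j _ => LinearMap.ext fun a => Subtype.ext (DFunLike.congr_fun (hcomm i j) a.1)
  obtain ⟨χ, hχ⟩ : ∃ χ : ι → 𝕜, ⨅ i, Module.End.eigenspace (R i) (χ i) ≠ ⊥ := by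
    by_contra! h
    exact bot_ne_top ((iSup_eq_bot.2 h).symm.trans hR)
  obtain ⟨a, ha, ha0⟩ := Submodule.exists_mem_ne_zero_of_ne_bot hχ
  refine ⟨a, ?_, fun i => ⟨χ i, congrArg Subtype.val <|
    Module.End.mem_eigenspace_iff.1 ((Submodule.mem_iInf _).1 ha i)⟩⟩
  rw [show T i₀ a = μ • a.1 from Module.End.mem_eigenspace_iff.1 a.2]
  exact smul_ne_zero hμ0 fun h => ha0 (Subtype.ext h)

theorem exists_joint_eigenvector_mem {𝕜 K ι : Type*} [RCLike 𝕜] [NormedAddCommGroup K]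
    [InnerProductSpace 𝕜 K] {T : ι → K →L[𝕜] K} (hT : ∀ i, (T i : K →ₗ[𝕜] K).IsSymmetric)
    (hcomm : ∀ i j, Commute (T i) (T j)) {H : Submodule 𝕜 K} [CompleteSpace H]
    (hH : ∀ i, ∀ a ∈ H, T i a ∈ H) {i₀ : ι} (hc : IsCompactOperator (T i₀)) {a : K} (ha : a ∈ H)
    (h0 : T i₀ a ≠ 0) : ∃ b ∈ H, T i₀ b ≠ 0 ∧ ∀ i, ∃ c : 𝕜, T i b = c • b := by
  obtain ⟨b, hb0, hb⟩ := exists_joint_eigenvector (T := fun i => (T i).restrict (hH i)) (i₀ := i₀)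
    (fun i => (hT i).restrict_invariant (hH i))
    (fun i j => ContinuousLinearMap.ext fun b => Subtype.ext (DFunLike.congr_fun (hcomm i j) b.1))
    (hc.restrict' (hH i₀)) fun h => h0 <| congrArg Subtype.val <| DFunLike.congr_fun h (⟨a, ha⟩ : H)
  refine ⟨b, b.2, fun h => hb0 (Subtype.ext h), fun i => ?_⟩
  obtain ⟨c, hcb⟩ := hb i
  exact ⟨c, congrArg Subtype.val hcb⟩

theorem mem_span_orthogonal_iff {𝕜 K : Type*} [RCLike 𝕜] [NormedAddCommGroup K]
    [InnerProductSpace 𝕜 K] {s : Set K} {a : K} :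
    a ∈ (Submodule.span 𝕜 s)ᗮ ↔ ∀ b ∈ s, inner 𝕜 b a = 0 := by
  rw [← Submodule.span_singleton_le_iff_mem, ← Submodule.isOrtho_iff_le, Submodule.isOrtho_comm,
    Submodule.isOrtho_span]
  simp only [Set.mem_singleton_iff, forall_eq]

/-- The operator on `ℓ₂` induced by `x` through the inclusions `ℓ₂ ⊆ s'` and `s ⊆ ℓ₂`. -/
def LSS.opL2 (x : LSS) : L2 →L[ℂ] L2 := (S.toL2 0).comp ((x : SDual →L[ℂ] S).comp (ofL2 0))

theorem LSS.opL2_apply (x : LSS) (a : L2) : x.opL2 a = S.toL2 0 (x (ofL2 0 a)) := rfl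

theorem LSS.opL2_toL2 (x : LSS) (ξ : S) : x.opL2 (S.toL2 0 ξ) = S.toL2 0 (x (incl ξ)) := by
  rw [opL2_apply, incl_eq_ofL2]

theorem LSS.opL2_mul (x y : LSS) : (x * y).opL2 = x.opL2 * y.opL2 :=
  ContinuousLinearMap.ext fun a => (opL2_toL2 x (y (ofL2 0 a))).symm

theorem LSS.commute_opL2 {x y : LSS} (h : x * y = y * x) : Commute x.opL2 y.opL2 := by
  rw [Commute, SemiconjBy, ← opL2_mul, h, opL2_mul]

theorem LSS.isSymmetric_opL2 {x : LSS} (hx : IsSelfAdjoint x) :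
    (x.opL2 : L2 →ₗ[ℂ] L2).IsSymmetric := fun a b => by
  change inner ℂ (x.opL2 a) b = inner ℂ a (x.opL2 b)
  rw [opL2_apply, opL2_apply, ← inner_conj_symm a, inner_toL2_left, inner_toL2_left, ← pair_star,
    hx.star_eq]

theorem LSS.isCompactOperator_opL2 (x : LSS) : IsCompactOperator x.opL2 := by
  obtain ⟨C, hC⟩ := SDual.exists_bound x 2 0
  refine isCompactOperator_of_norm_apply_le ENNReal.ofNat_ne_top (summable_inv_sq.mul_left C)
    fun a j => ?_
  have ha : WSummable (-((0 : ℕ) : ℤ)) (ofL2 0 a) := by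
    simpa [coe_ofL2, weight_zero] using wsummable_coe a
  have hnorm : wnorm (-((0 : ℕ) : ℤ)) (ofL2 0 a) = ‖a‖ := by
    simpa [coe_ofL2, weight_zero] using wnorm_coe a
  have hcoord : x.opL2 a j = x (ofL2 0 a) j := congrFun (weight_zero _) j
  rw [hcoord, zpow_neg, mul_right_comm, ← div_eq_mul_inv, le_div_iff₀ (by positivity), ← hnorm]
  exact (norm_coord_mul_le ((x (ofL2 0 a)).2 2) j).trans (hC _ ha)

/-! ### Minimal projections and the canonical basis -/

theorem exists_smul_pair_self_eq_one {ξ : S} (hξ : ξ ≠ 0) :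
    ∃ c : ℂ, pair (incl (c • ξ)) (c • ξ) = 1 := by
  have h0 : ‖S.toL2 0 ξ‖ ≠ 0 :=
    norm_ne_zero_iff.2 <| (map_ne_zero_iff (S.toL2 0) S.injective_toL2).2 hξ
  refine ⟨((‖S.toL2 0 ξ‖⁻¹ : ℝ) : ℂ), ?_⟩
  rw [pair_incl_self, map_smul_eq_mul, ← S.norm_toL2, Complex.norm_of_nonneg (by positivity),
    inv_mul_cancel₀ h0, one_pow, Complex.ofReal_one]

section MaximalCommutative

variable {E : NonUnitalStarSubalgebra ℂ LSS}

theorem rankOne_mul_comm_of_isSelfAdjoint {f : S} (hf : pair (incl f) f = 1) {x : LSS}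
    (hx : IsSelfAdjoint x) {c : ℂ} (h : x (incl f) = c • f) :
    x * rankOne f = rankOne f * x := by
  have hc : diagCoeff f x = c := by rw [diagCoeff_apply, h, map_smul, pair_smul, hf, mul_one]
  have hxf := mul_rankOne_eq_smul h
  have hfx := congrArg star hxf
  rw [star_mul, star_smul, hx.star_eq, (isSelfAdjoint_rankOne f).star_eq, ← hc,
    ← starRingEnd_apply, ← diagCoeff_star, hx.star_eq, hc] at hfx
  rw [hxf, hfx]

theorem mul_comm_of_forall_isSelfAdjoint {a : LSS}
    (h : ∀ x ∈ E, IsSelfAdjoint x → x * a = a * x) {x : LSS} (hx : x ∈ E) : x * a = a * x := by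
  let y : E := ⟨x, hx⟩
  have hre := h _ (realPart y).1.2 (congrArg Subtype.val (realPart y).2.star_eq)
  have him := h _ (imaginaryPart y).1.2 (congrArg Subtype.val (imaginaryPart y).2.star_eq)
  have hxy : x = (realPart y : E) + Complex.I • ((imaginaryPart y : E) : LSS) :=
    congrArg Subtype.val (realPart_add_I_smul_imaginaryPart y).symm
  rw [hxy, add_mul, mul_add, hre, smul_mul_assoc, mul_smul_comm, him]

/-- The unit vectors `f ∈ s` whose one-dimensional projection `⟨·, f⟩ f` belongs to `E`. For
maximal commutative `E` these are, up to scalars of modulus one, the minimal projections. -/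
def projectionVectors (E : NonUnitalStarSubalgebra ℂ LSS) : Set S :=
  {f | pair (incl f) f = 1 ∧ rankOne f ∈ E}

theorem smul_mem_projectionVectors (hE : IsClosedMaximalCommutative E) {ξ : S}
    (hξ : ∀ x ∈ E, IsSelfAdjoint x → ∃ c : ℂ, x (incl ξ) = c • ξ) {d : ℂ}
    (hd : pair (incl (d • ξ)) (d • ξ) = 1) : d • ξ ∈ projectionVectors E := by
  refine ⟨hd, hE.mem_of_isSelfAdjoint (isSelfAdjoint_rankOne _) fun x hx =>
    mul_comm_of_forall_isSelfAdjoint (fun y hy hya => ?_) hx⟩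
  obtain ⟨c, hc⟩ := hξ y hy hya
  exact rankOne_mul_comm_of_isSelfAdjoint hd hya
    (by rw [map_smul, LSS.map_smul, hc, smul_comm] : y (incl (d • ξ)) = c • d • ξ)

/-- The orthogonal complement in `ℓ₂` of `projectionVectors E`. It is an invariant subspace for
the operators induced by the self-adjoint elements of `E`. -/
def projectionComplement (E : NonUnitalStarSubalgebra ℂ LSS) : Submodule ℂ L2 :=
  (Submodule.span ℂ (S.toL2 0 '' projectionVectors E))ᗮ

instance : CompleteSpace (projectionComplement E) :=
  (Submodule.isClosed_orthogonal _).completeSpace_coe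

theorem mem_projectionComplement {a : L2} :
    a ∈ projectionComplement E ↔ ∀ f ∈ projectionVectors E, inner ℂ (S.toL2 0 f) a = 0 :=
  mem_span_orthogonal_iff.trans Set.forall_mem_image

theorem toL2_mem_projectionComplement {ξ : S} :
    S.toL2 0 ξ ∈ projectionComplement E ↔ ∀ f ∈ projectionVectors E, pair (incl ξ) f = 0 := by
  simp only [mem_projectionComplement, inner_toL2_toL2]

theorem opL2_mem_projectionComplement (hE : ∀ x ∈ E, ∀ y ∈ E, x * y = y * x) {x : LSS}
    (hx : x ∈ E) (hxa : IsSelfAdjoint x) {a : L2} (ha : a ∈ projectionComplement E) :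
    x.opL2 a ∈ projectionComplement E :=
  mem_projectionComplement.2 fun f hf => by
    have hsymm := LSS.isSymmetric_opL2 hxa (S.toL2 0 f) a
    rw [ContinuousLinearMap.coe_coe, LSS.opL2_toL2,
      apply_incl_eq_smul hf.1 (hE _ hf.2 _ hx), map_smul, inner_smul_left,
      mem_projectionComplement.1 ha f hf, mul_zero] at hsymm
    exact hsymm.symm

/-- A self-adjoint `x ∈ E` that is nonzero on the complement of `projectionVectors E` has, by the
spectral theorem, an eigenvector there that is shared by all of `E`. It lies in `s`, because `x`
maps into `s`, and its projection belongs to `E`: a contradiction. -/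
theorem opL2_eq_zero_of_mem_projectionComplement (hE : IsClosedMaximalCommutative E) {x : LSS}
    (hx : x ∈ E) (hxa : IsSelfAdjoint x) {a : L2} (ha : a ∈ projectionComplement E) :
    x.opL2 a = 0 := by
  by_contra hxa0
  obtain ⟨b, hbH, hb0, hb⟩ := exists_joint_eigenvector_mem
    (T := fun y : {y : LSS // y ∈ E ∧ IsSelfAdjoint y} => y.1.opL2) (i₀ := ⟨x, hx, hxa⟩)
    (fun y => LSS.isSymmetric_opL2 y.2.2)
    (fun y z => LSS.commute_opL2 (hE.1.2 _ y.2.1 _ z.2.1))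
    (fun y _ => opL2_mem_projectionComplement hE.1.2 y.2.1 y.2.2) x.isCompactOperator_opL2 ha hxa0
  let ξ : S := x (ofL2 0 b)
  have hξ : ∀ y ∈ E, IsSelfAdjoint y → ∃ c : ℂ, y (incl ξ) = c • ξ := fun y hy hya => by
    obtain ⟨c, hc⟩ := hb ⟨y, hy, hya⟩
    refine ⟨c, S.injective_toL2 ?_⟩
    calc S.toL2 0 (y (incl ξ)) = y.opL2 (x.opL2 b) := (y.opL2_toL2 ξ).symm
      _ = x.opL2 (y.opL2 b) :=
        DFunLike.congr_fun (LSS.commute_opL2 (hE.1.2 _ hy _ hx)) b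
      _ = S.toL2 0 (c • ξ) := by rw [hc, map_smul, map_smul]; rfl
  obtain ⟨d, hd⟩ := exists_smul_pair_self_eq_one
    (fun h => hb0 ((congrArg (S.toL2 0) h).trans (map_zero _)) : ξ ≠ 0)
  have hperp : S.toL2 0 (d • ξ) ∈ projectionComplement E := by
    rw [map_smul]
    exact Submodule.smul_mem _ d (opL2_mem_projectionComplement hE.1.2 hx hxa hbH)
  exact one_ne_zero (hd.symm.trans
    (toL2_mem_projectionComplement.1 hperp _ (smul_mem_projectionVectors hE hξ hd)))

theorem eq_zero_of_forall_projectionVectors (hE : IsClosedMaximalCommutative E) {ξ : S}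
    (hξ : ∀ f ∈ projectionVectors E, pair (incl ξ) f = 0) : ξ = 0 := by
  by_contra hξ0
  have hE0 : ∀ x ∈ E, IsSelfAdjoint x → ∃ c : ℂ, x (incl ξ) = c • ξ := fun x hx hxa => by
    refine ⟨0, S.injective_toL2 ?_⟩
    rw [← LSS.opL2_toL2, zero_smul, map_zero, opL2_eq_zero_of_mem_projectionComplement hE hx hxa
      (toL2_mem_projectionComplement.2 hξ)]
  obtain ⟨c, hc⟩ := exists_smul_pair_self_eq_one hξ0
  have h := hξ _ (smul_mem_projectionVectors hE hE0 hc)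
  rw [map_smul, pair_smul, h, mul_zero] at hc
  exact zero_ne_one hc

theorem diagCoeff_eq_one {f : S} (hf : pair (incl f) f = 1) {P : LSS}
    (hfP : rankOne f * P = P * rankOne f) (hP : IsIdempotentElem P) (h0 : diagCoeff f P ≠ 0) :
    diagCoeff f P = 1 := by
  refine mul_left_cancel₀ h0 ?_
  rw [← diagCoeff_mul hf hfP, hP.eq, mul_one]

theorem isMinimalProjection_rankOne (hE : ∀ x ∈ E, ∀ y ∈ E, x * y = y * x) {f : S}
    (hf : f ∈ projectionVectors E) : IsMinimalProjection E (rankOne f) where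
  mem := hf.2
  isStarProjection := isStarProjection_rankOne hf.1
  ne_zero := rankOne_ne_zero hf.1
  minimal Q hQ hQP hQ0 hQf := by
    have hcomm := hE _ hf.2 _ hQ
    have hQc : Q = diagCoeff f Q • rankOne f := by
      rw [← rankOne_mul_eq_smul hf.1 hcomm, hcomm, hQf]
    have hc : diagCoeff f Q ≠ 0 := fun h => hQ0 (by rw [hQc, h, zero_smul])
    rw [hQc, diagCoeff_eq_one hf.1 hcomm hQP.isIdempotentElem hc, one_smul]

theorem IsMinimalProjection.exists_rankOne_eq (hE : IsClosedMaximalCommutative E) {P : LSS}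
    (hP : IsMinimalProjection E P) : ∃ f ∈ projectionVectors E, rankOne f = P := by
  obtain ⟨η, hη⟩ : ∃ η, P η ≠ 0 := by
    by_contra! h
    exact hP.ne_zero (LSS.ext h)
  obtain ⟨f, hf, hfη⟩ : ∃ f ∈ projectionVectors E, pair (incl (P η)) f ≠ 0 := by
    by_contra! h
    exact hη (eq_zero_of_forall_projectionVectors hE h)
  have hcomm := hE.1.2 _ hf.2 _ hP.mem
  rw [pair_incl_apply_eq_mul hf.1 hcomm] at hfη
  refine ⟨f, hf, hP.minimal _ hf.2 (isStarProjection_rankOne hf.1) (rankOne_ne_zero hf.1) ?_⟩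
  rw [rankOne_mul_eq_smul hf.1 hcomm, diagCoeff_eq_one hf.1 hcomm
    hP.isStarProjection.isIdempotentElem (left_ne_zero_of_mul hfη), one_smul]

theorem pair_eq_zero_of_rankOne_ne {f g : S} (hf : pair (incl f) f = 1) (hg : pair (incl g) g = 1)
    (hcomm : rankOne f * rankOne g = rankOne g * rankOne f) (hne : rankOne f ≠ rankOne g) :
    pair (incl f) g = 0 := by
  by_contra h
  have hc : diagCoeff f (rankOne g) = diagCoeff g (rankOne f) := by
    simp only [diagCoeff_apply, rankOne_apply, map_smul, pair_smul, mul_comm]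
  have hc0 : diagCoeff f (rankOne g) ≠ 0 := by
    rw [diagCoeff_apply, rankOne_apply, map_smul, pair_smul, ← pair_incl_conj f g]
    exact mul_ne_zero h ((map_ne_zero conj).2 h)
  refine hne (smul_right_injective _ hc0 ?_)
  calc diagCoeff f (rankOne g) • rankOne f = rankOne f * rankOne g :=
        (rankOne_mul_eq_smul hf hcomm).symm
    _ = diagCoeff f (rankOne g) • rankOne g := by rw [hcomm, rankOne_mul_eq_smul hg hcomm.symm, hc]

theorem pair_eq_zero_of_rankOne_eq {f g : S} (hg : pair (incl g) g = 1)
    (h : rankOne f = rankOne g) {η : SDual} (hη : pair η f = 0) : pair η g = 0 := by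
  have hgη : rankOne g η = 0 := by rw [← h, rankOne_apply, hη, zero_smul]
  calc pair η g = pair (incl (rankOne g η)) g := by
        rw [rankOne_apply, map_smul, pair_smul, hg, mul_one]
    _ = 0 := by rw [hgη, map_zero]; exact map_zero (pairCLM g)

theorem countable_of_orthonormal_lp {𝕜 ι κ : Type*} [RCLike 𝕜] [Countable κ]
    {v : ι → lp (fun _ : κ => 𝕜) 2} (hv : Orthonormal 𝕜 v) : Countable ι := by
  classical
  have hsupp (j : κ) : {i | v i j ≠ 0}.Countable := by
    refine (hv.inner_products_summable (lp.single 2 j (1 : 𝕜))).countable_support.mono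
      fun i hi => ?_
    have hij : inner 𝕜 (v i) (lp.single 2 j (1 : 𝕜)) = conj (v i j) := by
      rw [lp.inner_single_right, RCLike.inner_apply, one_mul]
    rw [Function.mem_support, hij, RCLike.norm_conj]
    exact pow_ne_zero 2 (norm_ne_zero_iff.2 hi)
  refine Set.countable_univ_iff.1 ((Set.countable_iUnion hsupp).mono fun i _ => ?_)
  by_contra h
  simp only [Set.mem_iUnion, Set.mem_ofPred_eq, not_exists, not_not] at h
  exact hv.ne_zero i (lp.ext (funext h))

theorem S.linearIndependent_unitVec : LinearIndependent ℂ S.unitVec := by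
  let e : OrthonormalSeq := ⟨S.unitVec, fun k l => by
    rw [pair_unitVec_right]
    exact (Pi.single_apply k 1 l).trans (if_congr eq_comm rfl rfl)⟩
  exact e.orthonormal_toL2.linearIndependent.of_comp (S.toL2 0).toLinearMap

theorem infinite_of_forall_pair_eq_zero {ι : Type*} {g : ι → S}
    (hg : ∀ ξ : S, (∀ i, pair (incl ξ) (g i) = 0) → ξ = 0) : Infinite ι := by
  by_contra h
  have : Finite ι := not_infinite_iff_finite.1 h
  let T : S →ₗ[ℂ] ι → ℂ := LinearMap.pi fun i => (pairCLM (g i)).toLinearMap ∘ₗ incl.toLinearMap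
  have hT : Function.Injective T :=
    (injective_iff_map_eq_zero T).2 fun ξ hξ => hg ξ fun i => congrFun hξ i
  have : FiniteDimensional ℂ S := FiniteDimensional.of_injective T hT
  exact not_finite_iff_infinite.2 inferInstance S.linearIndependent_unitVec.finite

theorem exists_isCanonicalBasis (hE : IsClosedMaximalCommutative E) :
    ∃ f : OrthonormalSeq, IsCanonicalBasis E fun k => rankOne (f k) := by
  classical
  choose g hg hgP using fun P : {P : LSS // IsMinimalProjection E P} => P.2.exists_rankOne_eq hE
  have horth (P Q) : pair (incl (g P)) (g Q) = if P = Q then 1 else 0 := by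
    split_ifs with h
    · rw [h, (hg Q).1]
    · refine pair_eq_zero_of_rankOne_ne (hg P).1 (hg Q).1 (hE.1.2 _ (hg P).2 _ (hg Q).2) ?_
      rwa [hgP, hgP, Ne, ← Subtype.ext_iff]
  have horthonormal : Orthonormal ℂ fun P => S.toL2 0 (g P) := orthonormal_iff_ite.2 fun P Q => by
    exact (inner_toL2_toL2 _ _).trans ((horth Q P).trans (if_congr eq_comm rfl rfl))
  have hcountable := countable_of_orthonormal_lp horthonormal
  have hinfinite : Infinite {P : LSS // IsMinimalProjection E P} :=
    infinite_of_forall_pair_eq_zero (g := g) fun ξ hξ =>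
      eq_zero_of_forall_projectionVectors hE fun f hf => by
        let P : {P : LSS // IsMinimalProjection E P} := ⟨_, isMinimalProjection_rankOne hE.1.2 hf⟩
        exact pair_eq_zero_of_rankOne_eq hf.1 (hgP P) (hξ P)
  obtain ⟨e⟩ : Nonempty (ℕ ≃ {P : LSS // IsMinimalProjection E P}) := nonempty_equiv_of_countable
  refine ⟨⟨g ∘ e, fun k l => by simp only [Function.comp_apply, horth, e.injective.eq_iff]⟩, ?_⟩
  have hge (k : ℕ) : rankOne (g (e k)) = e k := hgP (e k)
  refine ⟨fun k l h => e.injective (Subtype.ext ?_), fun k => ?_, fun Q hQ => ?_⟩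
  · rwa [← hge, ← hge]
  · exact isMinimalProjection_rankOne hE.1.2 (hg (e k))
  · exact ⟨e.symm ⟨Q, hQ⟩, (hge _).trans (by rw [e.apply_symm_apply])⟩

theorem IsCanonicalBasis.isSComplete (hE : IsClosedMaximalCommutative E) {f : OrthonormalSeq}
    (hf : IsCanonicalBasis E fun k => rankOne (f k)) : f.IsSComplete := fun ξ hξ =>
  eq_zero_of_forall_projectionVectors hE fun g hg => by
    obtain ⟨k, hk⟩ := hf.exhaustive _ (isMinimalProjection_rankOne hE.1.2 hg)
    exact pair_eq_zero_of_rankOne_eq hg.1 hk (hξ k)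

end MaximalCommutative

end SmoothOp

end

theorem mainTheorem7 :
    (∀ E : NonUnitalStarSubalgebra ℂ LSS, IsClosedMaximalCommutative E →
      ∃ f : OrthonormalSeq, f.IsSComplete ∧ IsCanonicalBasis E (fun k => rankOne (f k)) ∧
        ∃ Φ : E ≃⋆ₐ[ℂ] LambdaInf f.matrix, IsFrechetIso Φ) ∧
    (∀ (E : NonUnitalStarSubalgebra ℂ LSS) (f : OrthonormalSeq), IsClosedMaximalCommutative E →
      ∀ hf : IsCanonicalBasis E (fun k => rankOne (f k)),
        f.IsSComplete ∧
        ∃! Φ : E ≃⋆ₐ[ℂ] LambdaInf f.matrix, IsFrechetIso Φ ∧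
          ∀ k, Φ ⟨rankOne (f k), (hf.isMinimalProjection k).mem⟩ = LambdaInf.e f.matrix k) ∧
    (∀ f : OrthonormalSeq, f.IsSComplete →
      ∃ E : NonUnitalStarSubalgebra ℂ LSS, IsClosedMaximalCommutative E ∧
        ∃ Φ : E ≃⋆ₐ[ℂ] LambdaInf f.matrix, IsFrechetIso Φ) := by
  refine ⟨fun E hE => ?existence, fun E f hE hf => ?uniqueness, fun f hf => ?converse⟩
  case existence =>
    obtain ⟨f, hf⟩ := exists_isCanonicalBasis hE
    have hcomplete := hf.isSComplete hE
    obtain rfl := hE.eq_diagSubalgebra hcomplete fun k => (hf.isMinimalProjection k).mem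
    exact ⟨f, hcomplete, hf, diagEquiv hcomplete, isFrechetIso_diagEquiv hcomplete⟩
  case uniqueness =>
    have hcomplete := hf.isSComplete hE
    obtain rfl := hE.eq_diagSubalgebra hcomplete fun k => (hf.isMinimalProjection k).mem
    exact ⟨hcomplete, diagEquiv hcomplete,
      ⟨isFrechetIso_diagEquiv hcomplete, diagEquiv_rankOne hcomplete⟩,
      fun Φ hΦ => eq_diagEquiv hcomplete hΦ.2⟩
  case converse =>
    exact ⟨diagSubalgebra f, isClosedMaximalCommutative_diagSubalgebra hf, diagEquiv hf,
      isFrechetIso_diagEquiv hf⟩
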